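/- Let $K$ be a number field with set of places $\Sigma_K$, adele ring $\mathbb{A}_K$, idele group $\mathbb{A}_K^*$ and idele class group $C_K=\mathbb{A}_K^*/K^*$, where $C_K$ carries the quotient of the usual idelic topology. Let $\|a\|=\prod_{v\in\Sigma_K}|a_v|_v$ (normalised absolute values) be the idelic norm, and write $\|\cdot\|$ also for the induced norm on $C_K$. Let $K^*$ act on $\mathbb{A}_K$ by multiplication. The quasi-orbit space $\mathcal{Q}(\mathbb{A}_K/K^*)$ is the quotient of $\mathbb{A}_K$ by the relation $a\sim b\iff\overline{K^*a}=\overline{K^*b}$, with the quotient topology. Define $$\Xi\colon\mathbb{A}_K\to 2^{\Sigma_K}\sqcup C_K,\qquad \Xi(a)=\begin{cases}\{v\in\Sigma_K : a_v=0\} & \text{if } a\notin\mathbb{A}_K^*,\\ aK^* & \text{if } a\in\mathbb{A}_K^*,\end{cases}$$ and give $2^{\Sigma_K}\sqcup C_K$ the quasi-orbit topology, in which a set is open if and only if its preimage under $\Xi$ is open in $\mathbb{A}_K$. Theorem. The map $\Xi$ descends to a bijection, hence a homeomorphism, from $\mathcal{Q}(\mathbb{A}_K/K^*)$ onto $2^{\Sigma_K}\sqcup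 C_K$. For every finite $F\subseteq\Sigma_K$, every real $\varepsilon>0$ and every open $V\subseteq C_K$ (in the idelic topology) such that $\|a\|>\varepsilon$ for all $a\in V$, the set $$U(F,\varepsilon,V)=U_F\sqcup\{a\in C_K : \|a\|<\varepsilon\}\sqcup V,\qquad U_F=\{T\subseteq\Sigma_K : T\cap F=\emptyset\},$$ is open in the quasi-orbit topology. Moreover, the sets $U(F,\varepsilon,V)$, for all such $F$, $\varepsilon$, $V$, form a basis of the quasi-orbit topology on $2^{\Sigma_K}\sqcup C_K$. -/

import Mathlib

open NumberField IsDedekindDomain Topology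

noncomputable section

/-- The relation of lying in the same quasi-orbit: the orbits have the same closure. -/
def quasiOrbitSetoid (G X : Type*) [Group G] [MulAction G X] [TopologicalSpace X] : Setoid X where
  r x y := closure (MulAction.orbit G x) = closure (MulAction.orbit G y)
  iseqv := ⟨fun _ => rfl, fun h => h.symm, fun h h' => h.trans h'⟩

/-- The quasi-orbit space of an action of `G` on a topological space `X`. -/
def QuasiOrbitSpace (G X : Type*) [Group G] [MulAction G X] [TopologicalSpace X] : Type _ :=
  Quotient (quasiOrbitSetoid G X)

/-- The quasi-orbit space carries the quotient topology. -/
instance (G X : Type*) [Group G] [MulAction G X] [TopologicalSpace X] :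
    TopologicalSpace (QuasiOrbitSpace G X) :=
  inferInstanceAs (TopologicalSpace (Quotient (quasiOrbitSetoid G X)))

/-- The quasi-orbit map. -/
def quasiOrbitMap (G X : Type*) [Group G] [MulAction G X] [TopologicalSpace X] (x : X) :
    QuasiOrbitSpace G X :=
  Quotient.mk (quasiOrbitSetoid G X) x

namespace NumberField

variable (K : Type*) [Field K] [NumberField K]

/-- The places of `K`: the infinite places, and the finite places, given by the nonzero
prime ideals of the ring of integers. -/
abbrev Place : Type _ := InfinitePlace K ⊕ HeightOneSpectrum (𝓞 K)

/-- The adele ring of `K`. -/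
abbrev Adele : Type _ := AdeleRing (𝓞 K) K

/-- The idele group of `K`, with the topology of the unit group of the adele ring. -/
abbrev Idele : Type _ := (Adele K)ˣ

/-- The diagonal embedding of `K*` into the ideles. -/
def principalIdele : Kˣ →* Idele K :=
  Units.map (algebraMap K (Adele K) : K →* Adele K)

/-- The idele class group of `K`, with the quotient topology of the ideles. -/
abbrev IdeleClassGroup : Type _ := Idele K ⧸ (principalIdele K).range

variable {K}

/-- The set of places at which an adele vanishes. -/
def zeroPlaces (a : Adele K) : Set (Place K) :=
  {v | Sum.elim (fun w : InfinitePlace K => a.1 w = 0)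
    (fun p : HeightOneSpectrum (𝓞 K) => a.2 p = 0) v}

/-- At almost all finite places, an idele has absolute value `1`. -/
lemma hasFiniteMulSupport_norm_idele (a : Idele K) :
    (Function.mulSupport fun p : HeightOneSpectrum (𝓞 K) => ‖(a : Adele K).2 p‖).Finite := by
  have ha : IsUnit (a : Adele K).2 := a.isUnit.map (RingHom.snd (InfiniteAdeleRing K) _)
  refine Set.Finite.subset (FiniteAdeleRing.isUnit_iff.1 ha).2 fun p hp => ?_
  intro h
  apply hp
  simp only [FinitePlace.norm_def]
  rw [h]
  simp

/-- The idelic norm: the product over all places of the normalised absolute values. At a complex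
place the normalised absolute value is the square of the usual one, and at a prime `p` it is
normalised by `|π| = 1 / N(p)` for a uniformiser `π`. -/
def ideleNorm : Idele K →* ℝ where
  toFun a := (∏ w : InfinitePlace K, ‖(a : Adele K).1 w‖ ^ w.mult) *
    ∏ᶠ p : HeightOneSpectrum (𝓞 K), ‖(a : Adele K).2 p‖
  map_one' := by
    have h1 (w : InfinitePlace K) : ((1 : Idele K) : Adele K).1 w = 1 := rfl
    have h2 (p : HeightOneSpectrum (𝓞 K)) : ((1 : Idele K) : Adele K).2 p = 1 := rfl
    simp only [h1, h2]
    simp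
  map_mul' a b := by
    have h1 (w : InfinitePlace K) : ((a * b : Idele K) : Adele K).1 w =
      (a : Adele K).1 w * (b : Adele K).1 w := rfl
    have h2 (p : HeightOneSpectrum (𝓞 K)) : ((a * b : Idele K) : Adele K).2 p =
      (a : Adele K).2 p * (b : Adele K).2 p := rfl
    simp only [h1, h2, norm_mul, mul_pow, Finset.prod_mul_distrib]
    rw [finprod_mul_distrib (hasFiniteMulSupport_norm_idele a) (hasFiniteMulSupport_norm_idele b)]
    ring

/-- The product formula. -/
lemma ideleNorm_principalIdele (x : Kˣ) : ideleNorm (principalIdele K x) = 1 := by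
  have h := prod_abs_eq_one (K := K) x.ne_zero
  rw [← finprod_comp_equiv FinitePlace.equivHeightOneSpectrum.symm] at h
  rw [← h]
  change (∏ w : InfinitePlace K, ‖((x : K) : w.Completion)‖ ^ w.mult) * _ = _
  congr 1
  refine Finset.prod_congr rfl fun w _ => ?_
  congr 1
  simp only [InfinitePlace.Completion.norm_ofCompletion, UniformSpace.Completion.norm_coe]
  rfl

/-- The norm on the idele class group. -/
def ideleClassNorm : IdeleClassGroup K →* ℝ :=
  QuotientGroup.lift _ ideleNorm (by
    rintro _ ⟨x, rfl⟩
    exact ideleNorm_principalIdele x)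

variable (K) in
/-- The disjoint union of the power set of the set of places and the idele class group. It is a
type of its own: its topology is not the one of a disjoint union. -/
def QuasiOrbitModel : Type _ := Set (Place K) ⊕ IdeleClassGroup K

namespace QuasiOrbitModel

/-- The inclusion of the power set of the set of places. -/
def ofSet (T : Set (Place K)) : QuasiOrbitModel K := Sum.inl T

/-- The inclusion of the idele class group. -/
def ofClass (c : IdeleClassGroup K) : QuasiOrbitModel K := Sum.inr c

end QuasiOrbitModel

open scoped Classical in
/-- The map that sends an idele to its class, and any other adele to its set of zeros. -/
def quasiOrbitXi (a : Adele K) : QuasiOrbitModel K :=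
  if h : IsUnit a then QuasiOrbitModel.ofClass (QuotientGroup.mk h.unit)
  else QuasiOrbitModel.ofSet (zeroPlaces a)

/-- The quasi-orbit topology: a set is open if and only if its preimage in the adeles is. -/
instance : TopologicalSpace (QuasiOrbitModel K) :=
  TopologicalSpace.coinduced quasiOrbitXi inferInstance

/-- The basic open set `U_F` of the power-cofinite topology. -/
def powerCofiniteBasic (F : Finset (Place K)) : Set (Set (Place K)) :=
  {T | T ∩ (F : Set (Place K)) = ∅}

/-- The disjoint union of `U_F`, of the set of idele classes of norm less than `ε`, and of `V`. -/
def quasiOrbitBasic (F : Finset (Place K)) (ε : ℝ) (V : Set (IdeleClassGroup K)) :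
    Set (QuasiOrbitModel K) :=
  QuasiOrbitModel.ofSet '' powerCofiniteBasic F ∪
    QuasiOrbitModel.ofClass '' {c | ideleClassNorm c < ε} ∪ QuasiOrbitModel.ofClass '' V

end NumberField

end

/-! The quasi-orbits are determined by two facts about orbit closures. The orbit of an idele is
closed: ideles near the adele 0 have small norm, whereas principal ideles have norm 1, so no element
of `Kˣ` is near 0 and `Kˣ` is closed in the adeles (`isClosed_orbit_idele`). The orbit closure of an
adele `a` that is not an idele consists of all adeles vanishing wherever `a` does
(`closure_orbit_of_not_isUnit`). Indeed ideles near `a` have small norm, and the orbit of an idele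
of sufficiently small norm enters any given neighbourhood, by Minkowski's theorem and cocompactness
of `K` (`exists_unit_placeAbs_sub_le`, `exists_smul_mem_of_ideleNorm_lt`). A field element moving
such an idele close to `b` also moves `a` close to `b`. So the fibres of `Ξ` are the quasi-orbits.

The sets `U(F, ε, V)` are open because the norm is upper semicontinuous for the adelic topology,
tends to 0 at the adeles that are not ideles, and because the adelic and idelic topologies agree
where the norm is bounded below (`eventually_mem_of_lt_ideleNorm`).

They form a basis because a nonempty open set contains all classes of small norm, and a
neighbourhood of `a` contains non-ideles with every zero set that avoids a certain finite set of
places where `a` is nonzero (`exists_not_isUnit_mem`). What is left of an open set is open in the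
idele class group. -/

noncomputable section

namespace NumberField

variable {K : Type*} [Field K] [NumberField K]

/-! ### Absolute values of adeles -/

/-- The absolute value at a place of the component of an adele at that place. -/
def placeAbs (v : Place K) (a : Adele K) : ℝ :=
  Sum.elim (fun w : InfinitePlace K => ‖a.1 w‖) (fun p : HeightOneSpectrum (𝓞 K) => ‖a.2 p‖) v

lemma placeAbs_inr (p : HeightOneSpectrum (𝓞 K)) (a : Adele K) :
    placeAbs (.inr p) a = ‖a.2 p‖ := rfl

lemma placeAbs_nonneg (v : Place K) (a : Adele K) : 0 ≤ placeAbs v a := by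
  cases v <;> exact norm_nonneg _

@[simp]
lemma placeAbs_zero (v : Place K) : placeAbs v (0 : Adele K) = 0 := by
  cases v <;> exact norm_zero

@[simp]
lemma placeAbs_one (v : Place K) : placeAbs v (1 : Adele K) = 1 := by
  cases v <;> exact norm_one

@[simp]
lemma placeAbs_mul (v : Place K) (a b : Adele K) :
    placeAbs v (a * b) = placeAbs v a * placeAbs v b := by
  cases v <;> exact norm_mul _ _

@[simp]
lemma placeAbs_neg (v : Place K) (a : Adele K) : placeAbs v (-a) = placeAbs v a := by
  cases v <;> exact norm_neg _

lemma placeAbs_add_le (v : Place K) (a b : Adele K) :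
    placeAbs v (a + b) ≤ placeAbs v a + placeAbs v b := by
  cases v <;> exact norm_add_le _ _

lemma placeAbs_sub_le (v : Place K) (a b : Adele K) :
    placeAbs v (a - b) ≤ placeAbs v a + placeAbs v b := by
  rw [sub_eq_add_neg, ← placeAbs_neg v b]
  exact placeAbs_add_le v a (-b)

/-- The norm is a strictly increasing function of the valuation, so the ultrametric inequality
carries over. -/
lemma norm_add_le_max (p : HeightOneSpectrum (𝓞 K)) (x y : p.adicCompletion K) :
    ‖x + y‖ ≤ max ‖x‖ ‖y‖ := by
  simp only [FinitePlace.norm_def]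
  rw [← NNReal.coe_max, NNReal.coe_le_coe,
    ← (WithZeroMulInt.toNNReal_strictMono
      (HeightOneSpectrum.one_lt_absNorm_nnreal p)).monotone.map_max]
  exact (WithZeroMulInt.toNNReal_strictMono
      (HeightOneSpectrum.one_lt_absNorm_nnreal p)).monotone (Valuation.map_add _ _ _)

lemma placeAbs_inr_add_le_max (p : HeightOneSpectrum (𝓞 K)) (a b : Adele K) :
    placeAbs (.inr p) (a + b) ≤ max (placeAbs (.inr p) a) (placeAbs (.inr p) b) :=
  norm_add_le_max p _ _

lemma placeAbs_inr_sub_le_max (p : HeightOneSpectrum (𝓞 K)) (a b : Adele K) :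
    placeAbs (.inr p) (a - b) ≤ max (placeAbs (.inr p) a) (placeAbs (.inr p) b) := by
  rw [sub_eq_add_neg, ← placeAbs_neg _ b]
  exact placeAbs_inr_add_le_max p a (-b)

/-- Adeles with the same component at a place have the same absolute value there. -/
lemma placeAbs_congr {v : Place K} {a b : Adele K} (h : placeAbs v (a - b) = 0) :
    placeAbs v a = placeAbs v b := by
  have h1 := placeAbs_add_le v (a - b) b
  have h2 := placeAbs_sub_le v a (a - b)
  simp only [sub_add_cancel, sub_sub_cancel] at h1 h2
  linarith

lemma placeAbs_sub_congr {v : Place K} {a b : Adele K} (h : placeAbs v (a - b) = 0)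
    (c : Adele K) : placeAbs v (a - c) = placeAbs v (b - c) :=
  placeAbs_congr (by rwa [sub_sub_sub_cancel_right])

lemma mem_zeroPlaces {a : Adele K} {v : Place K} : v ∈ zeroPlaces a ↔ placeAbs v a = 0 := by
  cases v <;> exact norm_eq_zero.symm

lemma placeAbs_infinite_algebraMap (w : InfinitePlace K) (x : K) :
    placeAbs (.inl w) (algebraMap K (Adele K) x) = w x :=
  InfinitePlace.Completion.norm_coe w _

lemma placeAbs_finite_algebraMap (p : HeightOneSpectrum (𝓞 K)) (x : K) :
    placeAbs (.inr p) (algebraMap K (Adele K) x) = ‖FinitePlace.embedding p x‖ := rfl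

lemma norm_le_one_iff (p : HeightOneSpectrum (𝓞 K)) (x : p.adicCompletion K) :
    ‖x‖ ≤ 1 ↔ x ∈ p.adicCompletionIntegers K := by
  rw [HeightOneSpectrum.mem_adicCompletionIntegers, FinitePlace.norm_def]
  exact_mod_cast WithZeroMulInt.toNNReal_le_one_iff (HeightOneSpectrum.one_lt_absNorm_nnreal p)

lemma norm_eq_one_iff (p : HeightOneSpectrum (𝓞 K)) (x : p.adicCompletion K) :
    ‖x‖ = 1 ↔ Valued.v x = 1 := by
  rw [FinitePlace.norm_def]
  exact_mod_cast WithZeroMulInt.toNNReal_eq_one_iff _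
    (HeightOneSpectrum.absNorm_ne_zero p) (HeightOneSpectrum.one_lt_absNorm_nnreal p).ne'

lemma finite_one_lt_placeAbs (a : Adele K) : {v : Place K | 1 < placeAbs v a}.Finite := by
  have h : {p : HeightOneSpectrum (𝓞 K) | 1 < placeAbs (.inr p) a}.Finite := by
    refine Set.Finite.subset (Filter.eventually_cofinite.1 a.2.2) fun p hp => ?_
    intro h
    exact absurd ((norm_le_one_iff p _).2 h) (not_le.2 hp)
  refine ((Set.finite_univ (α := InfinitePlace K)).image Sum.inl |>.union
    (h.image Sum.inr)).subset ?_
  rintro (w | p) hv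
  · exact Or.inl ⟨w, trivial, rfl⟩
  · exact Or.inr ⟨p, hv, rfl⟩

/-- Components that are integral at almost all places can be put together to an adele. -/
lemma exists_adele_placeAbs_sub_eq_zero (g : Place K → Adele K)
    (hg : {v | 1 < placeAbs v (g v)}.Finite) : ∃ a : Adele K, ∀ v, placeAbs v (a - g v) = 0 := by
  refine ⟨(fun w => (g (.inl w)).1 w, ⟨fun p => (g (.inr p)).2 p, ?_⟩), ?_⟩
  · refine Filter.eventually_cofinite.2
      ((hg.preimage Sum.inr_injective.injOn).subset fun p hp => ?_)
    by_contra h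
    exact hp ((norm_le_one_iff p _).1 (not_lt.1 h))
  · rintro (w | p)
    · exact norm_eq_zero.2 (sub_self _)
    · exact norm_eq_zero.2 (sub_self _)

/-- There are only finitely many infinite places, so they may be admitted to the exceptional set and
all places treated alike. -/
lemma isUnit_adele_iff {a : Adele K} :
    IsUnit a ↔ (∀ v, placeAbs v a ≠ 0) ∧ {v : Place K | placeAbs v a ≠ 1}.Finite := by
  have h1 : IsUnit a ↔ IsUnit a.1 ∧ IsUnit a.2 := Prod.isUnit_iff
  have h2 : IsUnit a.1 ↔ ∀ w, IsUnit (a.1 w) := Pi.isUnit_iff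
  rw [h1, h2, FiniteAdeleRing.isUnit_iff]
  simp only [isUnit_iff_ne_zero, ← norm_eq_one_iff, Filter.eventually_cofinite]
  constructor
  · rintro ⟨h, h', h''⟩
    refine ⟨?_, ((Set.finite_univ (α := InfinitePlace K)).image Sum.inl |>.union
      (h''.image Sum.inr)).subset ?_⟩
    · rintro (w | p)
      · exact norm_ne_zero_iff.2 (h w)
      · exact norm_ne_zero_iff.2 (h' p)
    rintro (w | p) hv
    · exact Or.inl ⟨w, trivial, rfl⟩
    · exact Or.inr ⟨p, hv, rfl⟩
  · rintro ⟨h, h'⟩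
    exact ⟨fun w => norm_ne_zero_iff.1 (h (.inl w)), fun p => norm_ne_zero_iff.1 (h (.inr p)),
      h'.preimage Sum.inr_injective.injOn⟩

lemma placeAbs_idele_pos (a : Idele K) (v : Place K) : 0 < placeAbs v (a : Adele K) :=
  (placeAbs_nonneg v _).lt_of_ne' ((isUnit_adele_iff.1 a.isUnit).1 v)

lemma placeAbs_inv (a : Idele K) (v : Place K) :
    placeAbs v ((a⁻¹ : Idele K) : Adele K) = (placeAbs v (a : Adele K))⁻¹ := by
  refine eq_inv_of_mul_eq_one_left ?_
  rw [← placeAbs_mul, Units.inv_mul, placeAbs_one]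

lemma ideleNorm_eq (a : Idele K) :
    ideleNorm a = (∏ w : InfinitePlace K, placeAbs (.inl w) (a : Adele K) ^ w.mult) *
      ∏ᶠ p : HeightOneSpectrum (𝓞 K), placeAbs (.inr p) (a : Adele K) := rfl

lemma ideleNorm_pos (a : Idele K) : 0 < ideleNorm a :=
  mul_pos (Finset.prod_pos fun w _ => pow_pos (placeAbs_idele_pos a (.inl w)) _)
    (finprod_induction (0 < ·) one_pos (fun _ _ => mul_pos)
      fun p => placeAbs_idele_pos a (.inr p))

lemma ideleNorm_inv (a : Idele K) : ideleNorm a⁻¹ = (ideleNorm a)⁻¹ := by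
  refine eq_inv_of_mul_eq_one_left ?_
  rw [← map_mul, inv_mul_cancel, map_one]

/-! ### Neighbourhoods in the adele ring -/

lemma continuous_placeAbs (v : Place K) : Continuous (placeAbs v : Adele K → ℝ) := by
  obtain w | p := v
  · exact (((continuous_apply w).comp continuous_fst).norm : Continuous fun a :
      ((w : InfinitePlace K) → w.Completion) × FiniteAdeleRing (𝓞 K) K => ‖a.1 w‖)
  · have h : Continuous fun a : FiniteAdeleRing (𝓞 K) K => a p :=
      RestrictedProduct.continuous_eval p
    exact (h.comp continuous_snd).norm

/-- The everywhere integral elements form an open additive subgroup; the neighbourhood is its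
translate by `x`. -/
lemma eventually_norm_sub_le_one (x : FiniteAdeleRing (𝓞 K) K) :
    ∀ᶠ y in 𝓝 x, ∀ p, ‖y p - x p‖ ≤ 1 := by
  have h0 : IsOpen {y : FiniteAdeleRing (𝓞 K) K | ∀ p, y p ∈ p.adicCompletionIntegers K} :=
    RestrictedProduct.isOpen_forall_mem fun p => Valued.isOpen_valuationSubring _
  have h1 : Continuous fun y : FiniteAdeleRing (𝓞 K) K => y - x := by fun_prop
  filter_upwards [(h0.preimage h1).mem_nhds
    (show ∀ p, (x - x) p ∈ p.adicCompletionIntegers K by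
      intro p; rw [sub_self]; exact zero_mem _)] with y hy p
  exact (norm_le_one_iff p _).2 (hy p)

/-- Translating by `x` reduces this to the integral elements, which map continuously from a plain
product, where neighbourhoods restrict only finitely many coordinates. -/
lemma exists_box_subset_finiteAdele {x : FiniteAdeleRing (𝓞 K) K}
    {U : Set (FiniteAdeleRing (𝓞 K) K)} (hU : U ∈ 𝓝 x) :
    ∃ S : Finset (HeightOneSpectrum (𝓞 K)), ∃ ε > 0, ∀ y : FiniteAdeleRing (𝓞 K) K,
      (∀ p ∈ S, ‖y p - x p‖ < ε) → (∀ p, ‖y p - x p‖ ≤ 1) → y ∈ U := by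
  let j : ((p : HeightOneSpectrum (𝓞 K)) → p.adicCompletionIntegers K) →
      FiniteAdeleRing (𝓞 K) K := RestrictedProduct.structureMap _ _ _
  have hj : Continuous j := RestrictedProduct.isEmbedding_structureMap.continuous
  have hc : Continuous fun z => x + j z := by fun_prop
  have h0 : (fun z => x + j z) ⁻¹' U ∈ 𝓝 (0 : (p : HeightOneSpectrum (𝓞 K)) →
      p.adicCompletionIntegers K) := by
    refine hc.continuousAt ?_
    have : x + j 0 = x := by
      ext p; exact add_zero _
    rwa [this]
  rw [nhds_pi, Filter.mem_pi] at h0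
  obtain ⟨I, hI, t, ht, hIt⟩ := h0
  have hball (p : HeightOneSpectrum (𝓞 K)) : ∃ ε > 0, ∀ z : p.adicCompletionIntegers K,
      ‖(z : p.adicCompletion K)‖ < ε → z ∈ t p := by
    have h := ht p
    rw [nhds_induced, Filter.mem_comap] at h
    obtain ⟨s, hs, hst⟩ := h
    obtain ⟨ε, hε, hεs⟩ := Metric.mem_nhds_iff.1 hs
    refine ⟨ε, hε, fun z hz => hst (hεs ?_)⟩
    rw [Metric.mem_ball, dist_eq_norm]
    simpa using hz
  choose ε hε hεt using hball
  have hmin : ∃ δ > 0, ∀ p ∈ hI.toFinset, δ ≤ ε p := by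
    rcases hI.toFinset.eq_empty_or_nonempty with h | h
    · exact ⟨1, one_pos, by simp [h]⟩
    · exact ⟨hI.toFinset.inf' h ε, (Finset.lt_inf'_iff h).2 fun p _ => hε p,
        fun p hp => Finset.inf'_le _ hp⟩
  obtain ⟨δ, hδ, hδε⟩ := hmin
  refine ⟨hI.toFinset, δ, hδ, fun y hy hy1 => ?_⟩
  have hy' : x + j (fun p => ⟨y p - x p, (norm_le_one_iff p _).1 (hy1 p)⟩) = y := by
    ext p; exact add_sub_cancel _ _
  rw [← hy']
  refine hIt fun p hp => hεt p _ ?_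
  exact (hy p (hI.mem_toFinset.2 hp)).trans_le (hδε p (hI.mem_toFinset.2 hp))

lemma eventually_placeAbs_sub_le_one (a : Adele K) :
    ∀ᶠ b in 𝓝 a, ∀ v, placeAbs v (b - a) ≤ 1 := by
  have h1 : ∀ᶠ b in 𝓝 a, ∀ w : InfinitePlace K, placeAbs (.inl w) (b - a) < 1 := by
    refine Filter.eventually_all.2 fun w => ?_
    have : Continuous fun b : Adele K => placeAbs (.inl w) (b - a) :=
      (continuous_placeAbs _).comp (by fun_prop)
    exact this.continuousAt.eventually_lt_const (by simp)
  have h2 : ∀ᶠ b in 𝓝 a, ∀ p : HeightOneSpectrum (𝓞 K), ‖b.2 p - a.2 p‖ ≤ 1 :=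
    continuous_snd.continuousAt.eventually (eventually_norm_sub_le_one a.2)
  filter_upwards [h1, h2] with b hb hb' v
  obtain w | p := v
  · exact (hb w).le
  · exact hb' p

/-- The neighbourhoods of an adele contain boxes. -/
lemma exists_box_subset {a : Adele K} {U : Set (Adele K)} (hU : U ∈ 𝓝 a) :
    ∃ S : Finset (Place K), ∃ ε > 0, ∀ b : Adele K, (∀ v ∈ S, placeAbs v (b - a) < ε) →
      (∀ v, placeAbs v (b - a) ≤ 1) → b ∈ U := by
  classical
  obtain ⟨U₁, hU₁, U₂, hU₂, h⟩ := mem_nhds_prod_iff.1 hU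
  obtain ⟨S, δ, hδ, hS⟩ := exists_box_subset_finiteAdele hU₂
  have hU₁' : U₁ ∈ @nhds ((w : InfinitePlace K) → w.Completion) Pi.topologicalSpace a.1 := hU₁
  obtain ⟨ε, hε, hεU⟩ := (Metric.mem_nhds_iff (α := (w : InfinitePlace K) → w.Completion)).1 hU₁'
  refine ⟨Finset.univ.image Sum.inl ∪ S.image Sum.inr, min ε δ, lt_min hε hδ,
    fun b hb hb1 => h ⟨hεU ?_, hS _ (fun p hp => ?_) fun p => hb1 (.inr p)⟩⟩
  · refine (dist_pi_lt_iff hε).2 fun w => ?_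
    rw [dist_eq_norm]
    exact (hb (.inl w) (by simp)).trans_le (min_le_left _ _)
  · exact (hb (.inr p) (by simp [hp])).trans_le (min_le_right _ _)

/-- The boxes are neighbourhoods. -/
lemma eventually_mem_box (a : Adele K) (S : Finset (Place K)) {ε : ℝ} (hε : 0 < ε) :
    ∀ᶠ b in 𝓝 a, (∀ v ∈ S, placeAbs v (b - a) < ε) ∧ ∀ v, placeAbs v (b - a) ≤ 1 := by
  refine Filter.Eventually.and ?_ (eventually_placeAbs_sub_le_one a)
  refine (Filter.eventually_all_finset S).2 fun v _ => ?_
  have : Continuous fun b : Adele K => placeAbs v (b - a) :=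
    (continuous_placeAbs v).comp (by fun_prop)
  exact this.continuousAt.eventually_lt_const (by simpa using hε)

/-- The adeles inject continuously into the full product of the completions. This allows a point to
be removed from a neighbourhood in `isClosed_range_algebraMap_units`. -/
instance : T2Space (Adele K) := by
  refine T2Space.of_injective_continuous (Y := ((w : InfinitePlace K) → w.Completion) ×
    ((p : HeightOneSpectrum (𝓞 K)) → p.adicCompletion K))
    (f := fun a => (a.1, fun p => a.2 p)) (fun a b h => ?_) ?_
  · obtain ⟨h1, h2⟩ := Prod.mk.inj h
    exact Prod.ext h1 (FiniteAdeleRing.ext K fun p => congrFun h2 p)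
  · have h : Continuous fun x : FiniteAdeleRing (𝓞 K) K => fun p => x p :=
      RestrictedProduct.continuous_coe
    exact continuous_fst.prodMk (h.comp continuous_snd)

/-! ### Discreteness of the finite absolute values, and integral elements -/

lemma one_lt_absNorm_real (p : HeightOneSpectrum (𝓞 K)) :
    (1 : ℝ) < (Ideal.absNorm p.asIdeal : ℝ) := by
  exact_mod_cast HeightOneSpectrum.one_lt_absNorm p

lemma exists_norm_eq_zpow (p : HeightOneSpectrum (𝓞 K)) {x : p.adicCompletion K} (hx : x ≠ 0) :
    ∃ k : ℤ, ‖x‖ = (Ideal.absNorm p.asIdeal : ℝ) ^ k := by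
  rw [FinitePlace.norm_def, WithZeroMulInt.toNNReal_neg_apply _
    ((Valuation.ne_zero_iff _).2 hx)]
  exact ⟨_, by push_cast; rfl⟩

lemma exists_norm_eq_inv_pow (p : HeightOneSpectrum (𝓞 K)) {x : p.adicCompletion K} (hx : x ≠ 0)
    (hx1 : ‖x‖ ≤ 1) : ∃ k : ℕ, ‖x‖ = ((Ideal.absNorm p.asIdeal : ℝ) ^ k)⁻¹ := by
  obtain ⟨k, hk⟩ := exists_norm_eq_zpow p hx
  rw [hk, zpow_le_one_iff_right₀ (one_lt_absNorm_real p)] at hx1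
  obtain ⟨m, rfl⟩ := Int.exists_eq_neg_ofNat hx1
  exact ⟨m, by rw [hk, zpow_neg, zpow_natCast]⟩

/-- The values are powers of the norm of `p`, which leaves a gap below 1. The gap makes infinitely
many non-unit components force small norms. -/
lemma norm_le_inv_absNorm (p : HeightOneSpectrum (𝓞 K)) {x : p.adicCompletion K}
    (hx1 : ‖x‖ < 1) : ‖x‖ ≤ (Ideal.absNorm p.asIdeal : ℝ)⁻¹ := by
  by_cases hx : x = 0
  · simp [hx]
  obtain ⟨k, hk⟩ := exists_norm_eq_inv_pow p hx hx1.le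
  have h0 : k ≠ 0 := by
    rintro rfl
    simp [hk] at hx1
  rw [hk]
  exact inv_anti₀ (zero_lt_one.trans (one_lt_absNorm_real p))
    (le_self_pow₀ (one_lt_absNorm_real p).le h0)

lemma norm_embedding_le_inv_pow_iff (p : HeightOneSpectrum (𝓞 K)) (x : 𝓞 K) (k : ℕ) :
    ‖FinitePlace.embedding p (x : K)‖ ≤ ((Ideal.absNorm p.asIdeal : ℝ) ^ k)⁻¹ ↔
      x ∈ p.asIdeal ^ k := by
  rw [← HeightOneSpectrum.intValuation_le_pow_iff_mem,
    ← (WithZeroMulInt.toNNReal_strictMono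
      (HeightOneSpectrum.one_lt_absNorm_nnreal p)).le_iff_le, FinitePlace.norm_embedding_int,
    ← NNReal.coe_le_coe]
  have h : WithZeroMulInt.toNNReal (HeightOneSpectrum.absNorm_ne_zero p)
      (WithZero.exp (-(k : ℤ))) = (Ideal.absNorm p.asIdeal : NNReal) ^ (-(k : ℤ)) := by
    rw [WithZeroMulInt.toNNReal_neg_apply _ (by simp)]
    rfl
  rw [h]
  push_cast
  rw [zpow_neg, zpow_natCast]

lemma exists_ne_zero_norm_embedding_le (p : HeightOneSpectrum (𝓞 K)) {ε : ℝ} (hε : 0 < ε) :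
    ∃ n : 𝓞 K, n ≠ 0 ∧ ‖FinitePlace.embedding p (n : K)‖ ≤ ε := by
  obtain ⟨π, hπ, h0⟩ := Submodule.exists_mem_ne_zero_of_ne_bot p.ne_bot
  obtain ⟨k, hk⟩ := exists_pow_lt_of_lt_one hε ((FinitePlace.norm_lt_one_iff_mem K p π).2 hπ)
  refine ⟨π ^ k, pow_ne_zero k h0, ?_⟩
  rw [← norm_pow, ← map_pow] at hk
  simpa using hk.le

/-- A product of one element for each bad prime works, as the other factors are integral. It serves
to clear denominators. -/
lemma exists_ne_zero_forall_norm_embedding_le {c : HeightOneSpectrum (𝓞 K) → ℝ}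
    (hc : ∀ p, 0 < c p) (hfin : {p | c p < 1}.Finite) :
    ∃ n : 𝓞 K, n ≠ 0 ∧ ∀ p, ‖FinitePlace.embedding p (n : K)‖ ≤ c p := by
  classical
  choose π hπ0 hπ using fun p => exists_ne_zero_norm_embedding_le p (hc p)
  refine ⟨∏ p ∈ hfin.toFinset, π p, Finset.prod_ne_zero_iff.2 fun p _ => hπ0 p, fun p => ?_⟩
  by_cases hp : c p < 1
  · rw [← Finset.mul_prod_erase _ _ (hfin.mem_toFinset.2 hp)]
    simp only [map_mul, norm_mul]
    exact (mul_le_of_le_one_right (norm_nonneg _) (FinitePlace.norm_le_one K p _)).trans (hπ p)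
  · exact (FinitePlace.norm_le_one K p _).trans (not_lt.1 hp)

/-! ### Minkowski's theorem -/

/-- Minkowski's theorem for the ideals of the ring of integers. -/
lemma exists_mem_ideal_lt_of_absNorm_lt : ∃ C : ℝ, 0 < C ∧ ∀ (I : Ideal (𝓞 K)), I ≠ ⊥ →
    ∀ r : InfinitePlace K → ℝ, (∀ w, 0 < r w) →
      C * Ideal.absNorm I < ∏ w, r w ^ w.mult → ∃ x ∈ I, x ≠ 0 ∧ ∀ w, w (x : K) < r w := by
  classical
  set V : ENNReal := MeasureTheory.volume
    (ZSpan.fundamentalDomain (mixedEmbedding.latticeBasis K)) *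
      2 ^ Module.finrank ℝ (mixedEmbedding.mixedSpace K) with hV
  have hVtop : V ≠ ⊤ := ENNReal.mul_ne_top
    (ZSpan.fundamentalDomain_isBounded _).measure_lt_top.ne (by finiteness)
  -- `V` is the Minkowski bound for the unit ideal; adding 1 makes the constant positive and the
  -- inequality strict.
  refine ⟨V.toReal + 1, by positivity, fun I hI r hr h => ?_⟩
  let J : (FractionalIdeal (nonZeroDivisors (𝓞 K)) K)ˣ :=
    FractionalIdeal.mk0 K ⟨I, mem_nonZeroDivisors_of_ne_zero hI⟩
  have hI0 : (0 : ℝ) < Ideal.absNorm I := by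
    have := Ideal.absNorm_ne_zero_of_nonZeroDivisors ⟨I, mem_nonZeroDivisors_of_ne_zero hI⟩
    exact_mod_cast Nat.pos_of_ne_zero this
  let f : InfinitePlace K → NNReal := fun w => ⟨r w, (hr w).le⟩
  have hbound : mixedEmbedding.minkowskiBound K J <
      MeasureTheory.volume (mixedEmbedding.convexBodyLT K f) := by
    rw [mixedEmbedding.convexBodyLT_volume, mixedEmbedding.minkowskiBound,
      mixedEmbedding.volume_fundamentalDomain_fractionalIdealLatticeBasis]
    have h1 : ((J : FractionalIdeal (nonZeroDivisors (𝓞 K)) K)) = (I : FractionalIdeal _ K) := rfl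
    rw [h1, FractionalIdeal.coeIdeal_absNorm, mul_assoc, ← hV]
    have h2 : ENNReal.ofReal ((Ideal.absNorm I : ℚ) : ℝ) * V =
        ENNReal.ofReal (V.toReal * Ideal.absNorm I) := by
      rw [mul_comm V.toReal, ENNReal.ofReal_mul hI0.le, ENNReal.ofReal_toReal hVtop]
      simp
    have h3 : ((∏ w, f w ^ w.mult : NNReal) : ENNReal) = ENNReal.ofReal (∏ w, r w ^ w.mult) := by
      rw [← ENNReal.ofReal_coe_nnreal]
      congr 1
      push_cast
      rfl
    rw [h2]
    -- The constant in the volume of the convex body is at least 1 and can be dropped.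
    refine lt_of_lt_of_le ?_ (le_mul_of_one_le_left' (a := ((∏ w, f w ^ w.mult : NNReal) : ENNReal))
      (ENNReal.one_le_coe_iff.2 (mixedEmbedding.one_le_convexBodyLTFactor K)))
    rw [h3]
    refine (ENNReal.ofReal_lt_ofReal_iff (Finset.prod_pos fun w _ => pow_pos (hr w) _)).2
      (lt_of_le_of_lt ?_ h)
    gcongr
    linarith
  obtain ⟨a, haJ, ha0, ha⟩ := mixedEmbedding.exists_ne_zero_mem_ideal_lt K J hbound
  obtain ⟨x, hxI, rfl⟩ := (FractionalIdeal.mem_coeIdeal _).1 haJ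
  exact ⟨x, hxI, fun h => ha0 (by rw [h, map_zero]), ha⟩

/-- Minkowski's theorem for ideles. -/
lemma exists_placeAbs_algebraMap_le : ∃ C : ℝ, 0 < C ∧ ∀ c : Idele K, C < ideleNorm c →
    ∃ y : Kˣ, ∀ v, placeAbs v (algebraMap K (Adele K) y) ≤ placeAbs v (c : Adele K) := by
  classical
  obtain ⟨C, hC, hmink⟩ := exists_mem_ideal_lt_of_absNorm_lt (K := K)
  refine ⟨C, hC, fun c hc => ?_⟩
  -- Multiplying `c` by `n` makes it integral at all primes and, by the product formula, preserves
  -- its norm.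
  obtain ⟨n, hn0, hn⟩ := exists_ne_zero_forall_norm_embedding_le (K := K)
    (c := fun p => (placeAbs (.inr p) (c : Adele K))⁻¹)
    (fun p => inv_pos.2 (placeAbs_idele_pos c _))
    (((finite_one_lt_placeAbs (c : Adele K)).preimage Sum.inr_injective.injOn).subset
      fun p hp => (inv_lt_one₀ (placeAbs_idele_pos c _)).1 hp)
  have hnK : (n : K) ≠ 0 := by exact_mod_cast hn0
  let u : Kˣ := Units.mk0 (n : K) hnK
  set d : Idele K := principalIdele K u * c with hd
  have hdv (v : Place K) : placeAbs v (d : Adele K) =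
      placeAbs v (algebraMap K (Adele K) n) * placeAbs v (c : Adele K) := by
    rw [hd, Units.val_mul, placeAbs_mul]; rfl
  have hdN : C < ideleNorm d := by
    rwa [hd, map_mul, ideleNorm_principalIdele, one_mul]
  have hd1 (p : HeightOneSpectrum (𝓞 K)) : placeAbs (.inr p) (d : Adele K) ≤ 1 := by
    rw [hdv]
    exact (le_mul_inv_iff₀ (placeAbs_idele_pos c _)).1 (by rw [one_mul]; exact hn p)
  choose k hk using fun p => exists_norm_eq_inv_pow p
    (norm_ne_zero_iff.1 (placeAbs_idele_pos d (.inr p)).ne') (hd1 p)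
  have hfin : (Function.mulSupport fun p : HeightOneSpectrum (𝓞 K) =>
      placeAbs (.inr p) (d : Adele K)).Finite := hasFiniteMulSupport_norm_idele d
  -- `I` encodes the finite part of the box: its elements satisfy the bounds of `d` at all primes,
  -- and the finite part of the norm of `d` is the inverse of the norm of `I`.
  let I : Ideal (𝓞 K) := ∏ p ∈ hfin.toFinset, p.asIdeal ^ k p
  have hI : I ≠ ⊥ := Finset.prod_ne_zero_iff.2 fun p _ => pow_ne_zero _ p.ne_bot
  have hnorm : ∏ᶠ p : HeightOneSpectrum (𝓞 K), placeAbs (.inr p) (d : Adele K) =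
      (Ideal.absNorm I : ℝ)⁻¹ := by
    rw [finprod_eq_prod _ hfin, map_prod, Nat.cast_prod, ← Finset.prod_inv_distrib]
    refine Finset.prod_congr rfl fun p _ => ?_
    rw [map_pow, Nat.cast_pow]
    exact hk p
  have hI0 : (0 : ℝ) < Ideal.absNorm I := by
    refine inv_pos.1 (hnorm ▸ ?_)
    exact finprod_induction (0 < ·) one_pos (fun _ _ => mul_pos)
      fun p => placeAbs_idele_pos d (.inr p)
  rw [ideleNorm_eq, hnorm, ← div_eq_mul_inv, lt_div_iff₀ hI0] at hdN
  obtain ⟨x, hxI, hx0, hx⟩ := hmink I hI _ (fun w => placeAbs_idele_pos d (.inl w)) hdN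
  have hxK : (x : K) ≠ 0 := by exact_mod_cast hx0
  have hxd (v : Place K) : placeAbs v (algebraMap K (Adele K) x) ≤ placeAbs v (d : Adele K) := by
    obtain w | p := v
    · rw [placeAbs_infinite_algebraMap]
      exact (hx w).le
    · by_cases hp : p ∈ hfin.toFinset
      · rw [placeAbs_finite_algebraMap, placeAbs_inr, hk p, norm_embedding_le_inv_pow_iff]
        exact Ideal.le_of_dvd (Finset.dvd_prod_of_mem _ hp) hxI
      · rw [hfin.mem_toFinset, Function.notMem_mulSupport] at hp
        rw [hp]
        exact FinitePlace.norm_le_one K p x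
  refine ⟨Units.mk0 (x : K) hxK / u, fun v => ?_⟩
  have hnv : 0 < placeAbs v (algebraMap K (Adele K) n) :=
    placeAbs_idele_pos (principalIdele K u) v
  refine le_of_mul_le_mul_left ?_ hnv
  rw [← hdv, ← placeAbs_mul, ← map_mul]
  have : (n : K) * ((Units.mk0 (x : K) hxK / u : Kˣ) : K) = x := by
    rw [Units.val_div_eq_div_val]; exact mul_div_cancel₀ _ hnK
  rw [this]
  exact hxd v

/-! ### Cocompactness of the field -/

/-- The ring of integers is dense in the integers of every completion. -/
lemma exists_integer_norm_sub_le (p : HeightOneSpectrum (𝓞 K)) {x : p.adicCompletion K}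
    (hx : ‖x‖ ≤ 1) {ε : ℝ} (hε : 0 < ε) :
    ∃ n : 𝓞 K, ‖FinitePlace.embedding p (n : K) - x‖ ≤ ε := by
  have hd : DenseRange (FinitePlace.embedding p : K → p.adicCompletion K) :=
    HeightOneSpectrum.denseRange_algebraMap K p
  -- The bound 1 makes `k` integral at `p`.
  obtain ⟨k, hk⟩ := hd.exists_dist_lt x (lt_min hε one_pos)
  rw [dist_eq_norm, norm_sub_rev] at hk
  have hk1 : p.valuation K k ≤ 1 := by
    rw [← HeightOneSpectrum.valuedAdicCompletion_eq_valuation',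
      ← HeightOneSpectrum.mem_adicCompletionIntegers, ← norm_le_one_iff]
    have := norm_add_le_max p (FinitePlace.embedding p k - x) x
    rw [sub_add_cancel] at this
    exact this.trans (max_le (hk.le.trans (min_le_right _ _)) hx)
  -- Only the valuation of `m` matters: it expresses the precision `ε` in the value group.
  obtain ⟨m, hm0, hm⟩ := exists_ne_zero_norm_embedding_le p hε
  obtain ⟨n, hn⟩ := p.exists_valuation_sub_lt_of_integer hk1
    (Units.mk0 (p.valuation K (m : K)) ((Valuation.ne_zero_iff _).2 (by exact_mod_cast hm0)))
  have hnk : ‖FinitePlace.embedding p ((n : K) - k)‖ ≤ ε := by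
    refine le_trans ?_ hm
    rw [FinitePlace.norm_embedding', FinitePlace.norm_embedding', NNReal.coe_le_coe]
    exact (WithZeroMulInt.toNNReal_strictMono
      (HeightOneSpectrum.one_lt_absNorm_nnreal p)).monotone hn.le
  refine ⟨n, ?_⟩
  have h := norm_add_le_max p (FinitePlace.embedding p ((n : K) - k)) (FinitePlace.embedding p k - x)
  rw [map_sub, sub_add_sub_cancel, ← map_sub] at h
  exact h.trans (max_le hnk (hk.le.trans (min_le_left _ _)))

/-- Strong approximation away from the infinite places, up to integral adeles. -/
lemma exists_forall_finite_placeAbs_sub_le_one (t : Adele K) :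
    ∃ x : K, ∀ p : HeightOneSpectrum (𝓞 K),
      placeAbs (.inr p) (algebraMap K (Adele K) x - t) ≤ 1 := by
  classical
  have hmax (p : HeightOneSpectrum (𝓞 K)) : 0 < max 1 (placeAbs (.inr p) t) :=
    lt_max_of_lt_left one_pos
  obtain ⟨n, hn0, hn⟩ := exists_ne_zero_forall_norm_embedding_le (K := K)
    (c := fun p => (max 1 (placeAbs (.inr p) t))⁻¹) (fun p => inv_pos.2 (hmax p))
    (((finite_one_lt_placeAbs t).preimage Sum.inr_injective.injOn).subset fun p hp => by
      simpa using (inv_lt_one₀ (hmax p)).1 hp)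
  have hnK : (n : K) ≠ 0 := by exact_mod_cast hn0
  have hnt (p : HeightOneSpectrum (𝓞 K)) : ‖FinitePlace.embedding p (n : K) * t.2 p‖ ≤ 1 := by
    rw [norm_mul]
    refine (mul_le_mul_of_nonneg_left (le_max_right _ _) (norm_nonneg _)).trans
      ((le_mul_inv_iff₀ (hmax p)).1 (by rw [one_mul]; exact hn p))
  have hpos (p : HeightOneSpectrum (𝓞 K)) : 0 < ‖FinitePlace.embedding p (n : K)‖ :=
    norm_pos_iff.2 ((map_ne_zero _).2 hnK)
  -- The precision required for `n * t` is the size of `n`, since the approximation is divided by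
  -- `n` at the end.
  choose a ha using fun p => exists_integer_norm_sub_le p (hnt p) (hpos p)
  choose e he using fun p => exists_norm_eq_inv_pow p (norm_pos_iff.1 (hpos p))
    (FinitePlace.norm_le_one K p n)
  have hfin : {p : HeightOneSpectrum (𝓞 K) | ¬ ‖FinitePlace.embedding p (n : K)‖ = 1}.Finite :=
    hasFiniteMulSupport_norm_idele (principalIdele K (Units.mk0 (n : K) hnK))
  -- The Chinese remainder theorem is needed only at the primes dividing `n`; elsewhere `n` is a
  -- unit and integrality suffices.
  obtain ⟨y, hy⟩ := IsDedekindDomain.exists_forall_sub_mem_ideal (s := hfin.toFinset)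
    (fun p : HeightOneSpectrum (𝓞 K) => p.asIdeal) e (fun p _ => p.prime)
    (fun p _ q _ hpq h => hpq (HeightOneSpectrum.ext h)) (fun p => a p)
  have hyt (p : HeightOneSpectrum (𝓞 K)) :
      ‖FinitePlace.embedding p (y : K) - FinitePlace.embedding p (n : K) * t.2 p‖ ≤
        ‖FinitePlace.embedding p (n : K)‖ := by
    by_cases hp : p ∈ hfin.toFinset
    · have h1 := (norm_embedding_le_inv_pow_iff p _ _).2 (hy p hp)
      rw [← he, RingOfIntegers.coe_eq_algebraMap, map_sub, map_sub] at h1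
      have h2 := norm_add_le_max p _ _ |>.trans (max_le h1 (ha p))
      rwa [sub_add_sub_cancel] at h2
    · rw [hfin.mem_toFinset, Set.mem_ofPred_eq, not_not] at hp
      rw [hp, sub_eq_add_neg]
      refine (norm_add_le_max p _ _).trans (max_le (FinitePlace.norm_le_one K p y) ?_)
      rw [norm_neg]
      exact hnt p
  refine ⟨y / n, fun p => ?_⟩
  change ‖FinitePlace.embedding p ((y : K) / n) - t.2 p‖ ≤ 1
  have h0 : FinitePlace.embedding p (n : K) ≠ 0 := (map_ne_zero _).2 hnK
  rw [map_div₀, div_sub' h0, norm_div]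
  exact div_le_one_of_le₀ (hyt p) (norm_nonneg _)

/-- The ring of integers is cocompact in the infinite adeles. -/
lemma exists_integer_infinite_placeAbs_sub_le : ∃ R : ℕ, 0 < R ∧ ∀ t : Adele K, ∃ x : 𝓞 K,
    ∀ w : InfinitePlace K, placeAbs (.inl w) (algebraMap K (Adele K) x - t) ≤ R := by
  -- 1 accounts for approximating `t` by an element of `K`, the sum for rounding its coordinates in
  -- an integral basis.
  obtain ⟨R, hR⟩ := exists_nat_ge (1 + ∑ w : InfinitePlace K, ∑ i, w (integralBasis K i))
  have hnn (w : InfinitePlace K) : 0 ≤ ∑ i, w (integralBasis K i) :=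
    Finset.sum_nonneg fun i _ => apply_nonneg _ _
  refine ⟨R, ?_, fun t => ?_⟩
  · have := Finset.sum_nonneg fun w (_ : w ∈ Finset.univ) => hnn w
    have h : (0 : ℝ) < R := by linarith
    exact_mod_cast h
  have hopen : ∀ᶠ b in 𝓝 t.1, ∀ w : InfinitePlace K, ‖b w - t.1 w‖ < 1 := by
    refine Filter.eventually_all.2 fun w => ?_
    have hc : Continuous fun b : InfiniteAdeleRing K => ‖b w - t.1 w‖ :=
      ((continuous_apply w).sub continuous_const).norm
    exact hc.continuousAt.eventually_lt_const (by simp)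
  obtain ⟨_, hk, ⟨k, rfl⟩⟩ :=
    mem_closure_iff_nhds.1 (InfiniteAdeleRing.denseRange_algebraMap K t.1) _ hopen
  let q := (integralBasis K).repr k
  let x : 𝓞 K := ∑ i, ⌊q i⌋ • RingOfIntegers.basis K i
  have hx : k - (x : K) = ∑ i, Int.fract (q i) • integralBasis K i := by
    have h1 : (x : K) = ∑ i, (⌊q i⌋ : ℚ) • integralBasis K i := by
      simp only [x, map_sum, map_zsmul, integralBasis_apply, Int.cast_smul_eq_zsmul]
    rw [h1]
    nth_rewrite 1 [← (integralBasis K).sum_repr k]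
    rw [← Finset.sum_sub_distrib]
    refine Finset.sum_congr rfl fun i _ => ?_
    rw [← sub_smul]; rfl
  refine ⟨x, fun w => ?_⟩
  have hw : w (k - x) ≤ ∑ i, w (integralBasis K i) := by
    rw [hx]
    refine (w.1.sum_le _ _).trans (Finset.sum_le_sum fun i _ => ?_)
    change w (Int.fract (q i) • integralBasis K i) ≤ w (integralBasis K i)
    rw [Rat.smul_def, map_mul]
    refine mul_le_of_le_one_left (apply_nonneg _ _) ?_
    rw [← InfinitePlace.norm_embedding_eq, map_ratCast, Complex.norm_ratCast, abs_of_nonneg]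
    · exact_mod_cast (Int.fract_lt_one (q i)).le
    · exact_mod_cast Int.fract_nonneg (q i)
  have h1 : placeAbs (.inl w) (algebraMap K (Adele K) k - t) ≤ 1 := (hk w).le
  have h2 : placeAbs (.inl w) (algebraMap K (Adele K) (k - x)) ≤ ∑ i, w (integralBasis K i) := by
    rwa [placeAbs_infinite_algebraMap]
  have h3 := placeAbs_sub_le (.inl w) (algebraMap K (Adele K) k - t)
    (algebraMap K (Adele K) (k - x))
  have h4 : algebraMap K (Adele K) k - t - algebraMap K (Adele K) (k - x) =
      algebraMap K (Adele K) x - t := by rw [map_sub]; ring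
  rw [h4] at h3
  have h5 := Finset.single_le_sum (fun w (_ : w ∈ Finset.univ) => hnn w) (Finset.mem_univ w)
  linarith

/-- The field is cocompact in the adeles. -/
lemma exists_placeAbs_sub_le : ∃ R : ℕ, 0 < R ∧ ∀ t : Adele K, ∃ x : K,
    (∀ w : InfinitePlace K, placeAbs (.inl w) (algebraMap K (Adele K) x - t) ≤ R) ∧
    ∀ p : HeightOneSpectrum (𝓞 K), placeAbs (.inr p) (algebraMap K (Adele K) x - t) ≤ 1 := by
  obtain ⟨R, hR0, hR⟩ := exists_integer_infinite_placeAbs_sub_le (K := K)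
  refine ⟨R, hR0, fun t => ?_⟩
  obtain ⟨x₀, hx₀⟩ := exists_forall_finite_placeAbs_sub_le_one t
  -- The correction at the infinite places is an algebraic integer, so it preserves integrality at
  -- the primes.
  obtain ⟨x₁, hx₁⟩ := hR (t - algebraMap K (Adele K) x₀)
  have h : algebraMap K (Adele K) (x₀ + x₁) - t =
      algebraMap K (Adele K) x₁ - (t - algebraMap K (Adele K) x₀) := by rw [map_add]; ring
  have h' : algebraMap K (Adele K) (x₀ + x₁) - t =
      algebraMap K (Adele K) x₁ + (algebraMap K (Adele K) x₀ - t) := by rw [map_add]; ring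
  refine ⟨x₀ + x₁, fun w => h ▸ hx₁ w, fun p => ?_⟩
  rw [h']
  exact (placeAbs_inr_add_le_max p _ _).trans (max_le (FinitePlace.norm_le_one K p x₁) (hx₀ p))

/-! ### Covering the adeles by translates of a box -/

/-- An idele with prescribed components, at almost all places units. -/
lemma exists_idele_placeAbs_sub_eq_zero (g : Place K → Adele K)
    (hg0 : ∀ v, placeAbs v (g v) ≠ 0) (hg : {v | placeAbs v (g v) ≠ 1}.Finite) :
    ∃ a : Idele K, ∀ v, placeAbs v ((a : Adele K) - g v) = 0 := by
  obtain ⟨a, ha⟩ := exists_adele_placeAbs_sub_eq_zero g (hg.subset fun v hv => ne_of_gt hv)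
  have hag (v : Place K) : placeAbs v a = placeAbs v (g v) := placeAbs_congr (ha v)
  have hu : IsUnit a := isUnit_adele_iff.2 ⟨fun v => hag v ▸ hg0 v, by simpa only [hag] using hg⟩
  exact ⟨hu.unit, ha⟩

/-- For an idele of large norm, the translates of the corresponding box by the nonzero elements
of the field cover the adeles. -/
lemma exists_unit_placeAbs_sub_le : ∃ C : ℝ, 0 < C ∧ ∀ c : Idele K, C < ideleNorm c →
    ∀ t : Adele K, ∃ x : Kˣ, ∀ v,
      placeAbs v (algebraMap K (Adele K) x - t) ≤ placeAbs v (c : Adele K) := by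
  obtain ⟨R, hR0, hR⟩ := exists_placeAbs_sub_le (K := K)
  obtain ⟨C, hC0, hC⟩ := exists_placeAbs_algebraMap_le (K := K)
  have hR1 : (1 : ℝ) ≤ R := by exact_mod_cast hR0
  have hRw (w : InfinitePlace K) : w ((2 * R : ℕ) : K) = 2 * R := by
    rw [← InfinitePlace.norm_embedding_eq, map_natCast, Complex.norm_natCast]
    push_cast; rfl
  -- Dividing by `z` shrinks the box by `2 * R` at the infinite places: `R` absorbs the
  -- cocompactness bound and 2 leaves room for avoiding `x = 0`.
  obtain ⟨z, hz⟩ := exists_idele_placeAbs_sub_eq_zero (K := K)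
    (Sum.elim (fun _ => algebraMap K (Adele K) (2 * R : ℕ)) fun _ => 1) (by
      rintro (w | p)
      · simp only [Sum.elim_inl]
        rw [placeAbs_infinite_algebraMap, hRw]
        positivity
      · simp) (by
      refine ((Set.finite_univ (α := InfinitePlace K)).image Sum.inl).subset ?_
      rintro (w | p) hv
      · exact ⟨w, trivial, rfl⟩
      · simp at hv)
  have hzw (w : InfinitePlace K) : placeAbs (.inl w) (z : Adele K) = 2 * R := by
    rw [placeAbs_congr (hz (.inl w)), Sum.elim_inl, placeAbs_infinite_algebraMap, hRw]
  have hzp (p : HeightOneSpectrum (𝓞 K)) : placeAbs (.inr p) (z : Adele K) = 1 := by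
    rw [placeAbs_congr (hz (.inr p)), Sum.elim_inr, placeAbs_one]
  refine ⟨C * ideleNorm z, mul_pos hC0 (ideleNorm_pos z), fun c hc t => ?_⟩
  obtain ⟨y, hy⟩ := hC (c * z⁻¹) (by
    rwa [map_mul, ideleNorm_inv, ← div_eq_mul_inv, lt_div_iff₀ (ideleNorm_pos z)])
  have hyw (w : InfinitePlace K) : 2 * R * placeAbs (.inl w) (algebraMap K (Adele K) y) ≤
      placeAbs (.inl w) (c : Adele K) := by
    have h := hy (.inl w)
    rw [Units.val_mul, placeAbs_mul, placeAbs_inv, hzw, ← div_eq_mul_inv,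
      le_div_iff₀ (by positivity)] at h
    linarith
  have hyp (p : HeightOneSpectrum (𝓞 K)) : placeAbs (.inr p) (algebraMap K (Adele K) y) ≤
      placeAbs (.inr p) (c : Adele K) := by
    have h := hy (.inr p)
    rwa [Units.val_mul, placeAbs_mul, placeAbs_inv, hzp, inv_one, mul_one] at h
  obtain ⟨x, hxw, hxp⟩ := hR (((principalIdele K y)⁻¹ : Idele K) * t)
  have hy1 : algebraMap K (Adele K) y * ((principalIdele K y)⁻¹ : Idele K) = 1 :=
    Units.mul_inv (principalIdele K y)
  have hxy : algebraMap K (Adele K) (y * x) - t = algebraMap K (Adele K) y *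
      (algebraMap K (Adele K) x - ((principalIdele K y)⁻¹ : Idele K) * t) := by
    rw [mul_sub, ← mul_assoc, hy1, one_mul, map_mul]
  have hw (w : InfinitePlace K) : 2 * placeAbs (.inl w) (algebraMap K (Adele K) (y * x) - t) ≤
      placeAbs (.inl w) (c : Adele K) := by
    rw [hxy, placeAbs_mul]
    have := mul_le_mul_of_nonneg_left (hxw w)
      (placeAbs_nonneg (.inl w) (algebraMap K (Adele K) y))
    linarith [hyw w]
  have hp (p : HeightOneSpectrum (𝓞 K)) :
      placeAbs (.inr p) (algebraMap K (Adele K) (y * x) - t) ≤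
        placeAbs (.inr p) (c : Adele K) := by
    rw [hxy, placeAbs_mul]
    exact (mul_le_of_le_one_right (placeAbs_nonneg _ _) (hxp p)).trans (hyp p)
  -- If the approximation is 0, then `t` itself is small, and the nonzero `y` takes its place at the
  -- cost of the spare factor 2.
  by_cases hx : x = 0
  · simp only [hx, mul_zero, map_zero, zero_sub, placeAbs_neg] at hw hp
    refine ⟨y, ?_⟩
    rintro (w | p)
    · have h1 := placeAbs_sub_le (.inl w) (algebraMap K (Adele K) y) t
      have h2 := mul_le_mul_of_nonneg_right hR1
        (placeAbs_nonneg (.inl w) (algebraMap K (Adele K) y))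
      linarith [hw w, hyw w]
    · exact (placeAbs_inr_sub_le_max p _ _).trans (max_le (hyp p) (hp p))
  · refine ⟨y * Units.mk0 x hx, ?_⟩
    rintro (w | p)
    · refine le_trans ?_ (hw w)
      exact le_mul_of_one_le_left (placeAbs_nonneg _ _) one_le_two
    · exact hp p

/-! ### The idelic norm in the adelic topology -/

lemma finite_one_lt_placeAbs_inr (a : Adele K) :
    {p : HeightOneSpectrum (𝓞 K) | 1 < placeAbs (.inr p) a}.Finite :=
  ((finite_one_lt_placeAbs a).preimage Sum.inr_injective.injOn).subset fun _ h => h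

/-- The product of the normalised absolute values at the infinite places and at a finite set
of primes. -/
def partialNorm (T : Finset (HeightOneSpectrum (𝓞 K))) (a : Adele K) : ℝ :=
  (∏ w : InfinitePlace K, placeAbs (.inl w) a ^ w.mult) * ∏ p ∈ T, placeAbs (.inr p) a

lemma continuous_partialNorm (T : Finset (HeightOneSpectrum (𝓞 K))) :
    Continuous (partialNorm T : Adele K → ℝ) :=
  (continuous_finsetProd _ fun w _ => (continuous_placeAbs (.inl w)).pow _).mul
    (continuous_finsetProd _ fun p _ => continuous_placeAbs (.inr p))

lemma partialNorm_nonneg (T : Finset (HeightOneSpectrum (𝓞 K))) (a : Adele K) :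
    0 ≤ partialNorm T a :=
  mul_nonneg (Finset.prod_nonneg fun _ _ => pow_nonneg (placeAbs_nonneg _ _) _)
    (Finset.prod_nonneg fun _ _ => placeAbs_nonneg _ _)

lemma ideleNorm_eq_partialNorm (a : Idele K) {T : Finset (HeightOneSpectrum (𝓞 K))}
    (hT : ∀ p ∉ T, placeAbs (.inr p) (a : Adele K) = 1) : ideleNorm a = partialNorm T a := by
  rw [ideleNorm_eq, partialNorm, finprod_eq_prod_of_mulSupport_subset]
  intro p hp
  by_contra h
  exact hp (hT p h)

lemma partialNorm_le_partialNorm {T T' : Finset (HeightOneSpectrum (𝓞 K))} (h : T ⊆ T')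
    {a : Adele K} (hT : ∀ p ∉ T, placeAbs (.inr p) a ≤ 1) : partialNorm T' a ≤ partialNorm T a := by
  classical
  rw [partialNorm, partialNorm, ← Finset.prod_sdiff h]
  refine mul_le_mul_of_nonneg_left ?_
    (Finset.prod_nonneg fun _ _ => pow_nonneg (placeAbs_nonneg _ _) _)
  exact mul_le_of_le_one_left (Finset.prod_nonneg fun _ _ => placeAbs_nonneg _ _)
    (Finset.prod_le_one (fun _ _ => placeAbs_nonneg _ _)
      fun p hp => hT p (Finset.mem_sdiff.1 hp).2)

lemma exists_ideleNorm_eq_partialNorm (a : Idele K) (T : Finset (HeightOneSpectrum (𝓞 K))) :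
    ∃ T', T ⊆ T' ∧ (∀ p ∉ T', placeAbs (.inr p) (a : Adele K) = 1) ∧
      ideleNorm a = partialNorm T' a := by
  classical
  have hfin : {p : HeightOneSpectrum (𝓞 K) | placeAbs (.inr p) (a : Adele K) ≠ 1}.Finite :=
    hasFiniteMulSupport_norm_idele a
  have h : ∀ p ∉ T ∪ hfin.toFinset, placeAbs (.inr p) (a : Adele K) = 1 := by
    intro p hp
    rw [Finset.mem_union, not_or, hfin.mem_toFinset] at hp
    exact not_not.1 hp.2
  exact ⟨_, Finset.subset_union_left, h, ideleNorm_eq_partialNorm a h⟩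

/-- The omitted factors are at most 1. Bounding the norm by a function continuous on the adeles
yields its upper semicontinuity. -/
lemma ideleNorm_le_partialNorm (a : Idele K) {T : Finset (HeightOneSpectrum (𝓞 K))}
    (hT : ∀ p ∉ T, placeAbs (.inr p) (a : Adele K) ≤ 1) : ideleNorm a ≤ partialNorm T a := by
  obtain ⟨T', h, -, h'⟩ := exists_ideleNorm_eq_partialNorm a T
  exact h'.trans_le (partialNorm_le_partialNorm h hT)

lemma eventually_placeAbs_le_one (a : Adele K) {T : Finset (HeightOneSpectrum (𝓞 K))}
    (hT : ∀ p ∉ T, placeAbs (.inr p) a ≤ 1) :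
    ∀ᶠ b in 𝓝 a, ∀ p ∉ T, placeAbs (.inr p) b ≤ 1 := by
  filter_upwards [eventually_placeAbs_sub_le_one a] with b hb p hp
  have h := placeAbs_inr_add_le_max p (b - a) a
  rw [sub_add_cancel] at h
  exact h.trans (max_le (hb _) (hT p hp))

/-- The idelic norm is upper semicontinuous in the topology of the adeles. -/
lemma eventually_ideleNorm_lt_of_partialNorm_lt {a : Adele K}
    {T : Finset (HeightOneSpectrum (𝓞 K))} (hT : ∀ p ∉ T, placeAbs (.inr p) a ≤ 1) {δ : ℝ}
    (h : partialNorm T a < δ) : ∀ᶠ b in 𝓝 a, ∀ c : Idele K, (c : Adele K) = b →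
      ideleNorm c < δ := by
  filter_upwards [eventually_placeAbs_le_one a hT,
    (continuous_partialNorm T).continuousAt.eventually_lt_const h] with b hb hb' c hc
  subst hc
  exact (ideleNorm_le_partialNorm c hb).trans_lt hb'

lemma eventually_ideleNorm_lt (a : Idele K) {δ : ℝ} (h : ideleNorm a < δ) :
    ∀ᶠ b in 𝓝 (a : Adele K), ∀ c : Idele K, (c : Adele K) = b → ideleNorm c < δ := by
  obtain ⟨T, -, hT, h'⟩ := exists_ideleNorm_eq_partialNorm a ∅
  exact eventually_ideleNorm_lt_of_partialNorm_lt (fun p hp => (hT p hp).le) (h' ▸ h)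

/-- Ideles close to an adele that is not an idele have small norm. -/
lemma eventually_ideleNorm_lt_of_not_isUnit {a : Adele K} (ha : ¬ IsUnit a) {ε : ℝ}
    (hε : 0 < ε) : ∀ᶠ b in 𝓝 a, ∀ c : Idele K, (c : Adele K) = b → ideleNorm c < ε := by
  classical
  set B := (finite_one_lt_placeAbs_inr a).toFinset with hB
  have hB1 : ∀ p ∉ B, placeAbs (.inr p) a ≤ 1 := fun p hp => by
    simpa [hB] using hp
  suffices ∃ T, B ⊆ T ∧ partialNorm T a < ε by
    obtain ⟨T, hBT, hT⟩ := this
    exact eventually_ideleNorm_lt_of_partialNorm_lt (fun p hp => hB1 p fun h => hp (hBT h)) hT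
  -- A zero component annihilates every partial norm that includes its place.
  by_cases h0 : ∃ v, placeAbs v a = 0
  · obtain ⟨w | p, hv⟩ := h0
    · refine ⟨B, subset_rfl, ?_⟩
      rw [partialNorm, Finset.prod_eq_zero (Finset.mem_univ w), zero_mul]
      · exact hε
      · rw [hv, zero_pow w.mult_ne_zero]
    · refine ⟨insert p B, Finset.subset_insert _ _, ?_⟩
      rw [partialNorm, Finset.prod_eq_zero (Finset.mem_insert_self p B) hv, mul_zero]
      exact hε
  push Not at h0
  -- Without zeros, a non-idele has infinitely many components of absolute value below 1, hence at
  -- most 1/2; enough of them make a partial norm small.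
  have hinf : {p : HeightOneSpectrum (𝓞 K) | placeAbs (.inr p) a < 1}.Infinite := by
    intro hfin
    refine ha (isUnit_adele_iff.2 ⟨h0, ?_⟩)
    refine ((Set.finite_univ (α := InfinitePlace K)).image Sum.inl |>.union
      ((hfin.union (finite_one_lt_placeAbs_inr a)).image Sum.inr)).subset ?_
    rintro (w | p) hv
    · exact Or.inl ⟨w, trivial, rfl⟩
    · exact Or.inr ⟨p, lt_or_gt_of_ne hv, rfl⟩
  obtain ⟨n, hn⟩ := exists_pow_lt_of_lt_one
    (show 0 < ε / (partialNorm B a + 1) by have := partialNorm_nonneg B a; positivity)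
    (show (1 / 2 : ℝ) < 1 by norm_num)
  obtain ⟨T, hT, hTn⟩ := hinf.exists_subset_card_eq n
  refine ⟨B ∪ T, Finset.subset_union_left, ?_⟩
  have hdisj : Disjoint B T := by
    refine Finset.disjoint_left.2 fun p hp hp' => ?_
    have h1 : placeAbs (.inr p) a < 1 := hT hp'
    have h2 : 1 < placeAbs (.inr p) a := (finite_one_lt_placeAbs_inr a).mem_toFinset.1 hp
    exact lt_asymm h1 h2
  have hhalf : ∏ p ∈ T, placeAbs (.inr p) a ≤ (1 / 2) ^ n := by
    rw [← hTn, ← Finset.prod_const]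
    refine Finset.prod_le_prod (fun _ _ => placeAbs_nonneg _ _) fun p hp => ?_
    refine (norm_le_inv_absNorm p (hT hp)).trans ?_
    rw [one_div]
    exact inv_anti₀ two_pos (by exact_mod_cast HeightOneSpectrum.one_lt_absNorm p)
  rw [partialNorm, Finset.prod_union hdisj, ← mul_assoc]
  change partialNorm B a * _ < ε
  have h1 := partialNorm_nonneg B a
  rw [lt_div_iff₀ (by positivity)] at hn
  have h2 := mul_le_mul_of_nonneg_left hhalf h1
  have h3 : (0 : ℝ) < (1 / 2) ^ n := by positivity
  nlinarith

/-- At each place this controls inverses by a function of `b` that is continuous at `a` in the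
adelic topology. -/
lemma placeAbs_inv_sub_inv (a b : Idele K) (v : Place K) :
    placeAbs v ((b⁻¹ : Idele K) - (a⁻¹ : Idele K) : Adele K) =
      placeAbs v ((b : Adele K) - a) / (placeAbs v (b : Adele K) * placeAbs v (a : Adele K)) := by
  have h : ((b⁻¹ : Idele K) - (a⁻¹ : Idele K) : Adele K) =
      -(((b⁻¹ : Idele K) : Adele K) * (a⁻¹ : Idele K) * ((b : Adele K) - a)) := by
    have h1 := Units.inv_mul b
    have h2 := Units.inv_mul a
    linear_combination ((a⁻¹ : Idele K) : Adele K) * h1 - ((b⁻¹ : Idele K) : Adele K) * h2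
  rw [h, placeAbs_neg, placeAbs_mul, placeAbs_mul, placeAbs_inv, placeAbs_inv]
  field_simp

/-- On the ideles of norm bounded from below, the topology of the ideles is that of the adeles. -/
lemma eventually_mem_of_lt_ideleNorm (a : Idele K) {V : Set (Idele K)} (hV : V ∈ 𝓝 a) {ε : ℝ}
    (hε : 0 < ε) : ∀ᶠ b in 𝓝 (a : Adele K), ∀ c : Idele K, (c : Adele K) = b →
      ε < ideleNorm c → c ∈ V := by
  classical
  -- The idele topology is induced by the pair of an idele and its inverse, so only the inverse
  -- needs control.
  rw [Units.isEmbedding_embedProduct.nhds_eq_comap, Filter.mem_comap] at hV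
  obtain ⟨W, hW, hWV⟩ := hV
  obtain ⟨W₁, hW₁, W₂', hW₂', hWW⟩ := mem_nhds_prod_iff.1 hW
  have hW₂ : MulOpposite.op ⁻¹' W₂' ∈ 𝓝 ((a⁻¹ : Idele K) : Adele K) :=
    MulOpposite.continuous_op.continuousAt hW₂'
  obtain ⟨S, δ, hδ, hS⟩ := exists_box_subset hW₂
  -- Outside `T` all primes have norm above this bound. A non-unit component of `c` there would cost
  -- a factor `1 / N(p)` and push the norm, otherwise at most `2 * ideleNorm a`, below `ε`.
  have hsmall : {p : HeightOneSpectrum (𝓞 K) |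
      (Ideal.absNorm p.asIdeal : ℝ) ≤ 2 * ideleNorm a / ε}.Finite := by
    refine ((Ideal.finite_setOfPred_absNorm_le (S := 𝓞 K) ⌊2 * ideleNorm a / ε⌋₊).preimage
      (HeightOneSpectrum.asIdeal_injective.injOn)).subset fun p hp => ?_
    exact Nat.le_floor hp
  obtain ⟨T, hsT, hT, haT⟩ := exists_ideleNorm_eq_partialNorm a hsmall.toFinset
  have hcont : ∀ᶠ b in 𝓝 (a : Adele K),
      ∀ v ∈ S ∪ T.image Sum.inr ∪ Finset.univ.image Sum.inl,
        placeAbs v (b - a) / (placeAbs v b * placeAbs v (a : Adele K)) < min δ 1 := by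
    refine (Filter.eventually_all_finset _).2 fun v _ => ?_
    have h0 := (placeAbs_idele_pos a v).ne'
    have h1 : ContinuousAt (fun b : Adele K =>
        placeAbs v (b - a) / (placeAbs v b * placeAbs v (a : Adele K))) a := by
      refine ContinuousAt.div ?_ ?_ (mul_ne_zero h0 h0)
      · exact ((continuous_placeAbs v).comp (continuous_id.sub continuous_const)).continuousAt
      · exact ((continuous_placeAbs v).mul continuous_const).continuousAt
    exact h1.eventually_lt_const (by simpa using lt_min hδ one_pos)
  have hlt := (continuous_partialNorm T).continuousAt.eventually_lt_const
    (show partialNorm T (a : Adele K) < 2 * ideleNorm a by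
      rw [← haT]; linarith [ideleNorm_pos a])
  filter_upwards [hcont, hlt, hW₁, eventually_placeAbs_le_one (a : Adele K)
    (fun p hp => (hT p hp).le)] with b hb hbT hbW hb1 c hc hcε
  subst hc
  have hone : ∀ p ∉ T, placeAbs (.inr p) (c : Adele K) = 1 := by
    intro p hp
    by_contra hne
    have hle : placeAbs (.inr p) (c : Adele K) ≤ (Ideal.absNorm p.asIdeal : ℝ)⁻¹ :=
      norm_le_inv_absNorm p ((hb1 p hp).lt_of_ne hne)
    have hp' : 2 * ideleNorm a / ε < (Ideal.absNorm p.asIdeal : ℝ) := by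
      by_contra h
      exact hp (hsT (hsmall.mem_toFinset.2 (not_lt.1 h)))
    have h1 : ideleNorm c ≤ partialNorm (insert p T) (c : Adele K) :=
      ideleNorm_le_partialNorm c fun q hq => hb1 q fun h => hq (Finset.mem_insert_of_mem h)
    have h2 : partialNorm (insert p T) (c : Adele K) =
        placeAbs (.inr p) (c : Adele K) * partialNorm T (c : Adele K) := by
      rw [partialNorm, partialNorm, Finset.prod_insert hp]; ring
    have hNp : (0 : ℝ) < (Ideal.absNorm p.asIdeal : ℝ) :=
      zero_lt_one.trans (one_lt_absNorm_real p)
    rw [div_lt_iff₀ hε] at hp'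
    have h3 : placeAbs (.inr p) (c : Adele K) * partialNorm T (c : Adele K) ≤
        (Ideal.absNorm p.asIdeal : ℝ)⁻¹ * (2 * ideleNorm a) :=
      mul_le_mul hle hbT.le (partialNorm_nonneg _ _) (inv_nonneg.2 hNp.le)
    have h4 : (Ideal.absNorm p.asIdeal : ℝ)⁻¹ * (2 * ideleNorm a) < ε := by
      rw [inv_mul_lt_iff₀ hNp]; exact hp'
    linarith
  refine hWV (hWW ⟨hbW, hS _ (fun v hv => ?_) fun v => ?_⟩)
  · rw [placeAbs_inv_sub_inv]
    exact (hb v (by simp [hv])).trans_le (min_le_left _ _)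
  · by_cases hv : v ∈ S ∪ T.image Sum.inr ∪ Finset.univ.image Sum.inl
    · rw [placeAbs_inv_sub_inv]
      exact (hb v hv).le.trans (min_le_right _ _)
    · obtain w | p := v
      · simp at hv
      · have hp : p ∉ T := fun h => hv (by simp [h])
        refine (placeAbs_inr_sub_le_max p _ _).trans ?_
        rw [placeAbs_inv, placeAbs_inv, hone p hp, hT p hp]
        simp

/-- Inversion is continuous on the ideles and inverts the norm, so upper semicontinuity implies
lower semicontinuity. -/
lemma continuous_ideleNorm : Continuous (ideleNorm : Idele K → ℝ) := by
  have husc (a : Idele K) {δ : ℝ} (h : ideleNorm a < δ) : ∀ᶠ c in 𝓝 a, ideleNorm c < δ :=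
    (Units.continuous_val.continuousAt.eventually (eventually_ideleNorm_lt a h)).mono
      fun c hc => hc c rfl
  refine continuous_iff_continuousAt.2 fun a => tendsto_order.2 ⟨fun δ h => ?_, fun δ h => husc a h⟩
  rcases le_or_gt δ 0 with hδ | hδ
  · exact Filter.Eventually.of_forall fun c => hδ.trans_lt (ideleNorm_pos c)
  · have h1 : ideleNorm a⁻¹ < δ⁻¹ := by
      rw [ideleNorm_inv]; exact inv_strictAnti₀ hδ h
    filter_upwards [(continuous_inv (G := Idele K)).continuousAt.eventually (husc a⁻¹ h1)]
      with c hc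
    rw [ideleNorm_inv] at hc
    exact (inv_lt_inv₀ (ideleNorm_pos c) hδ).1 hc

/-! ### Approximation by ideles and by non-ideles -/

/-- Each rational prime lies in some prime ideal, and coprime integers cannot lie in the same one.
This provides non-ideles without any zero component. -/
lemma infinite_heightOneSpectrum : Infinite (HeightOneSpectrum (𝓞 K)) := by
  have hover (ℓ : Nat.Primes) : ∃ p : HeightOneSpectrum (𝓞 K), ((ℓ : ℕ) : 𝓞 K) ∈ p.asIdeal := by
    have hnu : ¬ IsUnit ((ℓ : ℕ) : 𝓞 K) := by
      intro h
      have h1 := h.map (Algebra.norm ℤ)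
      rw [← map_natCast (algebraMap ℤ (𝓞 K)), Algebra.norm_algebraMap, isUnit_pow_iff
        Module.finrank_pos.ne', Int.isUnit_iff_natAbs_eq] at h1
      exact ℓ.2.one_lt.ne' (by simpa using h1)
    obtain ⟨m, hm, hmem⟩ := exists_max_ideal_of_mem_nonunits hnu
    refine ⟨⟨m, hm.isPrime, fun h => ?_⟩, hmem⟩
    rw [h, Ideal.mem_bot] at hmem
    exact ℓ.2.ne_zero (by exact_mod_cast hmem)
  choose f hf using hover
  refine Infinite.of_injective f fun ℓ ℓ' h => ?_
  by_contra hne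
  have hco : Nat.Coprime ℓ ℓ' :=
    (Nat.coprime_primes ℓ.2 ℓ'.2).2 fun h => hne (Subtype.ext h)
  refine (f ℓ).isPrime.ne_top ((Ideal.eq_top_iff_one _).2 ?_)
  have h1 : IsCoprime ((ℓ : ℕ) : 𝓞 K) ((ℓ' : ℕ) : 𝓞 K) := hco.cast
  obtain ⟨x, y, hxy⟩ := h1
  rw [← hxy]
  exact add_mem (Ideal.mul_mem_left _ _ (hf ℓ)) (Ideal.mul_mem_left _ _ (h ▸ hf ℓ'))

lemma exists_placeAbs_pos_lt (v : Place K) {ε : ℝ} (hε : 0 < ε) :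
    ∃ d : Adele K, 0 < placeAbs v d ∧ placeAbs v d < ε := by
  suffices ∃ x : K, x ≠ 0 ∧ placeAbs v (algebraMap K (Adele K) x) < ε by
    obtain ⟨x, hx, h⟩ := this
    exact ⟨_, placeAbs_idele_pos (principalIdele K (Units.mk0 x hx)) v, h⟩
  obtain w | p := v
  · obtain ⟨n, hn⟩ := exists_nat_one_div_lt hε
    refine ⟨((n + 1 : ℕ) : K)⁻¹, inv_ne_zero (by exact_mod_cast n.succ_ne_zero), ?_⟩
    rw [placeAbs_infinite_algebraMap, map_inv₀, ← InfinitePlace.norm_embedding_eq, map_natCast,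
      Complex.norm_natCast, ← one_div]
    exact_mod_cast hn
  · obtain ⟨n, hn0, hn⟩ := exists_ne_zero_norm_embedding_le p (half_pos hε)
    exact ⟨n, by exact_mod_cast hn0, hn.trans_lt (half_lt_self hε)⟩

/-- A finite set of places, containing a given one and all infinite places, outside of which
given adeles are integral. -/
lemma exists_finset_place (a b : Adele K) (S : Finset (Place K)) :
    ∃ S', S ⊆ S' ∧ (∀ w, .inl w ∈ S') ∧
      (∀ v ∉ S', placeAbs v a ≤ 1) ∧ ∀ v ∉ S', placeAbs v b ≤ 1 := by
  classical
  refine ⟨S ∪ Finset.univ.image Sum.inl ∪ (finite_one_lt_placeAbs a).toFinset ∪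
    (finite_one_lt_placeAbs b).toFinset, fun v hv => by simp [hv], fun w => by simp,
    fun v hv => ?_, fun v hv => ?_⟩
  all_goals
    simp only [Finset.mem_union, not_or, Set.Finite.mem_toFinset] at hv
  · exact not_lt.1 hv.1.2
  · exact not_lt.1 hv.2

lemma unit_smul_eq (x : Kˣ) (a : Adele K) : x • a = algebraMap K (Adele K) x * a := by
  rw [Units.smul_def, Algebra.smul_def]

/-- The orbits of the ideles of small norm meet every nonempty open set. -/
lemma exists_smul_mem_of_ideleNorm_lt {a : Adele K} {U : Set (Adele K)} (hU : U ∈ 𝓝 a) :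
    ∃ ε > 0, ∀ b : Idele K, ideleNorm b < ε → ∃ x : Kˣ, x • (b : Adele K) ∈ U := by
  classical
  obtain ⟨S, δ, hδ, hS⟩ := exists_box_subset hU
  obtain ⟨C, hC, hkey⟩ := exists_unit_placeAbs_sub_le (K := K)
  choose d hd0 hd using fun v : Place K => exists_placeAbs_pos_lt v (lt_min hδ one_pos)
  -- `c` describes a box inside the neighbourhood; it is rescaled by `b⁻¹`, and small norm of `b`
  -- makes the rescaled box large enough to cover.
  obtain ⟨c, hc⟩ := exists_idele_placeAbs_sub_eq_zero (fun v => if v ∈ S then d v else 1)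
    (fun v => by
      split_ifs with h
      · exact (hd0 v).ne'
      · simp)
    (S.finite_toSet.subset fun v hv => by
      by_contra h
      rw [Finset.mem_coe] at h
      simp [h] at hv)
  have hcv (v : Place K) := placeAbs_congr (hc v)
  refine ⟨ideleNorm c / C, div_pos (ideleNorm_pos c) hC, fun b hb => ?_⟩
  obtain ⟨x, hx⟩ := hkey (c * b⁻¹) (by
    rw [map_mul, ideleNorm_inv, ← div_eq_mul_inv, lt_div_iff₀ (ideleNorm_pos b), mul_comm]
    exact (lt_div_iff₀ hC).1 hb) ((b⁻¹ : Idele K) * a)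
  have hxb (v : Place K) : placeAbs v (x • (b : Adele K) - a) ≤ placeAbs v (c : Adele K) := by
    have h : x • (b : Adele K) - a =
        (b : Adele K) * (algebraMap K (Adele K) x - (b⁻¹ : Idele K) * a) := by
      rw [unit_smul_eq, mul_sub, ← mul_assoc (b : Adele K), Units.mul_inv, one_mul, mul_comm]
    rw [h, placeAbs_mul]
    refine (mul_le_mul_of_nonneg_left (hx v) (placeAbs_nonneg _ _)).trans_eq ?_
    rw [Units.val_mul, placeAbs_mul, placeAbs_inv, mul_left_comm,
      mul_inv_cancel₀ (placeAbs_idele_pos b v).ne', mul_one]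
  refine ⟨x, hS _ (fun v hv => (hxb v).trans_lt ?_) fun v => (hxb v).trans ?_⟩
  · rw [hcv, if_pos hv]
    exact (hd v).trans_le (min_le_left _ _)
  · rw [hcv]
    split_ifs
    · exact (hd v).le.trans (min_le_right _ _)
    · simp

/-- Approximation of an adele by an idele with given components. -/
lemma exists_idele_mem (a : Adele K) {U : Set (Adele K)} (hU : U ∈ 𝓝 a) (S : Finset (Place K)) :
    ∃ c : Idele K, (c : Adele K) ∈ U ∧
      (∀ v ∈ S, placeAbs v a ≠ 0 → placeAbs v ((c : Adele K) - a) = 0) ∧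
      ∀ v, placeAbs v a ≤ 1 → placeAbs v a ≤ placeAbs v (c : Adele K) ∧
        placeAbs v (c : Adele K) ≤ 1 := by
  classical
  obtain ⟨S₀, δ, hδ, hS₀⟩ := exists_box_subset hU
  obtain ⟨S', hSS', hinf, ha, -⟩ := exists_finset_place a a (S ∪ S₀)
  choose d hd0 hd using fun v : Place K => exists_placeAbs_pos_lt v (lt_min hδ one_pos)
  -- On `S'` zeros of `a` become small nonzero values and other components are kept; the components
  -- 1 elsewhere dominate the integral ones of `a`.
  let g : Place K → Adele K := fun v => if v ∈ S' then if placeAbs v a = 0 then d v else a else 1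
  have hg1 {v : Place K} (h : v ∈ S') (h' : placeAbs v a = 0) : g v = d v := by simp [g, h, h']
  have hg2 {v : Place K} (h : v ∈ S') (h' : placeAbs v a ≠ 0) : g v = a := by simp [g, h, h']
  have hg3 {v : Place K} (h : v ∉ S') : g v = 1 := by simp [g, h]
  obtain ⟨c, hc⟩ := exists_idele_placeAbs_sub_eq_zero g
    (fun v => by
      by_cases h : v ∈ S'
      · by_cases h' : placeAbs v a = 0
        · rw [hg1 h h']; exact (hd0 v).ne'
        · rwa [hg2 h h']
      · simp [hg3 h])
    (S'.finite_toSet.subset fun v hv => by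
      by_contra h
      simp [hg3 h] at hv)
  have hcv (v : Place K) := placeAbs_congr (hc v)
  have hd' {v : Place K} (h' : placeAbs v a = 0) : placeAbs v (d v - a) < min δ 1 := by
    have := placeAbs_sub_le v (d v) a
    rw [h', add_zero] at this
    exact this.trans_lt (hd v)
  refine ⟨c, hS₀ _ (fun v hv => ?_) fun v => ?_, fun v hv h' => ?_, fun v hv => ?_⟩
  · have hvS := hSS' (Finset.mem_union_right S hv)
    rw [placeAbs_sub_congr (hc v)]
    by_cases h' : placeAbs v a = 0
    · rw [hg1 hvS h']
      exact (hd' h').trans_le (min_le_left _ _)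
    · rw [hg2 hvS h', sub_self, placeAbs_zero]
      exact hδ
  · rw [placeAbs_sub_congr (hc v)]
    by_cases h : v ∈ S'
    · by_cases h' : placeAbs v a = 0
      · rw [hg1 h h']
        exact (hd' h').le.trans (min_le_right _ _)
      · rw [hg2 h h', sub_self, placeAbs_zero]
        exact zero_le_one
    · obtain w | p := v
      · exact absurd (hinf w) h
      · rw [hg3 h]
        exact (placeAbs_inr_sub_le_max p _ _).trans (max_le (by simp) (ha _ h))
  · have h := hc v
    rwa [hg2 (hSS' (Finset.mem_union_left S₀ hv)) h'] at h
  · rw [hcv]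
    by_cases h : v ∈ S'
    · by_cases h' : placeAbs v a = 0
      · rw [hg1 h h', h']
        exact ⟨(hd0 v).le, (hd v).le.trans (min_le_right _ _)⟩
      · rw [hg2 h h']
        exact ⟨le_rfl, hv⟩
    · rw [hg3 h, placeAbs_one]
      exact ⟨hv, le_rfl⟩

/-- Approximation of an adele by adeles that are not ideles, with given sets of zeros. -/
lemma exists_not_isUnit_mem (a : Adele K) {U : Set (Adele K)} (hU : U ∈ 𝓝 a) :
    ∃ F : Finset (Place K), zeroPlaces a ∩ F = ∅ ∧ ∀ T : Set (Place K), T ∩ F = ∅ →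
      ∃ b ∈ U, ¬ IsUnit b ∧ zeroPlaces b = T := by
  classical
  obtain ⟨S, δ, hδ, hS⟩ := exists_box_subset hU
  obtain ⟨S', hSS', hinf, ha, -⟩ := exists_finset_place a a S
  choose d hd0 hd using fun v : Place K => exists_placeAbs_pos_lt v (lt_min hδ one_pos)
  refine ⟨S'.filter fun v => v ∉ zeroPlaces a, ?_, fun T hT => ?_⟩
  · ext v
    simp only [Set.mem_inter_iff, Finset.mem_coe, Finset.mem_filter, Set.mem_empty_iff_false,
      iff_false, not_and]
    tauto
  have hT' {v : Place K} (hv : v ∈ T) (h : v ∈ S') : placeAbs v a = 0 := by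
    by_contra h'
    have : v ∈ T ∩ ↑(S'.filter fun v => v ∉ zeroPlaces a) :=
      ⟨hv, Finset.mem_coe.2 (Finset.mem_filter.2 ⟨h, fun h0 => h' (mem_zeroPlaces.1 h0)⟩)⟩
    rw [hT] at this
    exact this
  -- Outside `S'` every component has absolute value below 1, so the adele is not an idele even when
  -- `T` is empty.
  let g : Place K → Adele K := fun v =>
    if v ∈ T then 0 else if v ∈ S' ∧ placeAbs v a ≠ 0 then a else d v
  have hg1 {v : Place K} (h : v ∈ T) : g v = 0 := by simp [g, h]
  have hg2 {v : Place K} (h : v ∉ T) (h' : v ∈ S' ∧ placeAbs v a ≠ 0) : g v = a := by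
    simp only [g, if_neg h, if_pos h']
  have hg3 {v : Place K} (h : v ∉ T) (h' : ¬ (v ∈ S' ∧ placeAbs v a ≠ 0)) : g v = d v := by
    simp only [g, if_neg h, if_neg h']
  have hout {v : Place K} (h : v ∉ S') : placeAbs v (g v) < 1 := by
    by_cases hv : v ∈ T
    · simp [hg1 hv]
    · rw [hg3 hv fun h' => h h'.1]
      exact (hd v).trans_le (min_le_right _ _)
  obtain ⟨b, hb⟩ := exists_adele_placeAbs_sub_eq_zero g (S'.finite_toSet.subset fun v hv => by
    by_contra h
    exact lt_asymm (hout h) hv)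
  have hbv (v : Place K) := placeAbs_congr (hb v)
  have hin {v : Place K} (h : v ∈ S') : placeAbs v (b - a) < min δ 1 := by
    rw [placeAbs_sub_congr (hb v)]
    by_cases hv : v ∈ T
    · rw [hg1 hv, zero_sub, placeAbs_neg, hT' hv h]
      exact lt_min hδ one_pos
    · by_cases h' : placeAbs v a = 0
      · rw [hg3 hv fun h1 => h1.2 h']
        have := placeAbs_sub_le v (d v) a
        rw [h', add_zero] at this
        exact this.trans_lt (hd v)
      · rw [hg2 hv ⟨h, h'⟩, sub_self, placeAbs_zero]
        exact lt_min hδ one_pos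
  refine ⟨b, hS _ (fun v hv => (hin (hSS' hv)).trans_le (min_le_left _ _)) fun v => ?_, ?_, ?_⟩
  · by_cases h : v ∈ S'
    · exact (hin h).le.trans (min_le_right _ _)
    · obtain w | p := v
      · exact absurd (hinf w) h
      · refine (placeAbs_inr_sub_le_max p _ _).trans (max_le ?_ (ha _ h))
        rw [hbv]
        exact (hout h).le
  · intro hu
    have hfin := (isUnit_adele_iff.1 hu).2
    have : Infinite (HeightOneSpectrum (𝓞 K)) := infinite_heightOneSpectrum
    obtain ⟨p, hp⟩ := ((hfin.union S'.finite_toSet).preimage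
      (Sum.inr_injective (α := InfinitePlace K)).injOn).exists_notMem
    simp only [Set.mem_preimage, Set.mem_union, not_or] at hp
    refine hp.1 ?_
    show placeAbs (.inr p) b ≠ 1
    rw [hbv]
    exact (hout hp.2).ne
  · ext v
    rw [mem_zeroPlaces, hbv]
    by_cases hv : v ∈ T
    · simp [hg1 hv, hv]
    · simp only [hv, iff_false]
      by_cases h' : v ∈ S' ∧ placeAbs v a ≠ 0
      · rw [hg2 hv h']; exact h'.2
      · rw [hg3 hv h']; exact (hd0 v).ne'

/-! ### Orbit closures -/

lemma zeroPlaces_smul (x : Kˣ) (a : Adele K) : zeroPlaces (x • a) = zeroPlaces a := by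
  ext v
  have hx : 0 < placeAbs v (algebraMap K (Adele K) x) := placeAbs_idele_pos (principalIdele K x) v
  rw [mem_zeroPlaces, mem_zeroPlaces, unit_smul_eq, placeAbs_mul, mul_eq_zero_iff_left hx.ne']

/-- The closure of the orbit of an adele that is not an idele. -/
lemma closure_orbit_of_not_isUnit {a : Adele K} (ha : ¬ IsUnit a) :
    closure (MulAction.orbit Kˣ a) = {b | zeroPlaces a ⊆ zeroPlaces b} := by
  refine subset_antisymm (closure_minimal ?_ ?_) fun b hb => mem_closure_iff_nhds.2 fun U hU => ?_
  · rintro _ ⟨x, rfl⟩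
    exact (zeroPlaces_smul x a).ge
  · have : {b : Adele K | zeroPlaces a ⊆ zeroPlaces b} =
        ⋂ v ∈ zeroPlaces a, {b | placeAbs v b = 0} := by
      ext b
      simp only [Set.mem_iInter, Set.subset_def, mem_zeroPlaces]
      rfl
    rw [this]
    exact isClosed_biInter fun v _ => isClosed_eq (continuous_placeAbs v) continuous_const
  obtain ⟨S, δ, hδ, hS⟩ := exists_box_subset hU
  obtain ⟨S', hSS', hinf, haS, hbS⟩ := exists_finset_place a b S
  obtain ⟨ε, hε, hεU⟩ := exists_smul_mem_of_ideleNorm_lt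
    (eventually_mem_box b S' (lt_min hδ one_pos))
  -- `c` has small norm, agrees with `a` at its nonzero components in `S'`, and dominates `a`
  -- outside `S'`. So the `x` bringing `c` near `b` also brings `a` near `b`; where `a` vanishes, so
  -- does `b`.
  obtain ⟨c, hcε, hca, hc1⟩ := exists_idele_mem a (eventually_ideleNorm_lt_of_not_isUnit ha hε) S'
  obtain ⟨x, hx, hx1⟩ := hεU c (hcε c rfl)
  have hin {v : Place K} (h : v ∈ S') : placeAbs v (x • a - b) < min δ 1 := by
    by_cases h0 : placeAbs v a = 0
    · have hb0 : placeAbs v b = 0 := mem_zeroPlaces.1 (hb (mem_zeroPlaces.2 h0))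
      have := placeAbs_sub_le v (x • a) b
      rw [hb0, unit_smul_eq, placeAbs_mul, h0, mul_zero, add_zero, ← unit_smul_eq] at this
      exact this.trans_lt (lt_min hδ one_pos)
    · rw [← placeAbs_sub_congr (a := x • (c : Adele K)) (v := v) (c := b)]
      · exact hx v h
      · rw [← smul_sub, unit_smul_eq, placeAbs_mul, hca v h h0, mul_zero]
  refine ⟨x • a, hS _ (fun v hv => (hin (hSS' hv)).trans_le (min_le_left _ _)) fun v => ?_, ⟨x, rfl⟩⟩
  by_cases h : v ∈ S'
  · exact (hin h).le.trans (min_le_right _ _)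
  obtain w | p := v
  · exact absurd (hinf w) h
  refine (placeAbs_inr_sub_le_max p _ _).trans (max_le ?_ (hbS _ h))
  have h1 : placeAbs (.inr p) (x • (c : Adele K)) ≤ 1 := by
    have := placeAbs_inr_add_le_max p (x • (c : Adele K) - b) b
    rw [sub_add_cancel] at this
    exact this.trans (max_le (hx1 _) (hbS _ h))
  refine le_trans ?_ h1
  rw [unit_smul_eq, unit_smul_eq, placeAbs_mul, placeAbs_mul]
  exact mul_le_mul_of_nonneg_left (hc1 _ (haS _ h)).1 (placeAbs_nonneg _ _)

lemma not_isUnit_zero_adele : ¬ IsUnit (0 : Adele K) := by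
  obtain ⟨w⟩ := (inferInstance : Nonempty (InfinitePlace K))
  exact fun h => (isUnit_adele_iff.1 h).1 (.inl w) (placeAbs_zero _)

/-- The field is discrete in the adeles. -/
lemma eventually_principalIdele_ne :
    ∀ᶠ b in 𝓝 (0 : Adele K), ∀ x : Kˣ, (principalIdele K x : Adele K) ≠ b := by
  filter_upwards [eventually_ideleNorm_lt_of_not_isUnit (K := K) not_isUnit_zero_adele one_pos]
    with b hb x hx
  exact (hb _ hx).ne (ideleNorm_principalIdele x)

/-- Two distinct elements of `Kˣ` differ by an element of `Kˣ`, which is never near 0. So every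
point has a neighbourhood with at most one of them. -/
lemma isClosed_range_algebraMap_units :
    IsClosed (Set.range fun x : Kˣ => algebraMap K (Adele K) x) := by
  refine isClosed_of_closure_subset fun b hb => ?_
  have hsub : ∀ᶠ y in 𝓝 b ×ˢ 𝓝 b, ∀ x : Kˣ, (principalIdele K x : Adele K) ≠ y.1 - y.2 := by
    rw [← nhds_prod_eq]
    have h : ContinuousAt (fun y : Adele K × Adele K => y.1 - y.2) (b, b) :=
      (continuous_fst.sub continuous_snd).continuousAt
    refine h.eventually (p := fun b => ∀ x : Kˣ, (principalIdele K x : Adele K) ≠ b) ?_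
    simp only [sub_self]
    exact eventually_principalIdele_ne
  obtain ⟨W, hW, hWW⟩ := Filter.eventually_prod_self_iff (r := fun y z : Adele K =>
    ∀ x : Kˣ, (principalIdele K x : Adele K) ≠ y - z) |>.1 hsub
  obtain ⟨_, hxW, ⟨x, rfl⟩⟩ := mem_closure_iff_nhds.1 hb W hW
  by_contra hne
  have hbx : b ≠ algebraMap K (Adele K) x := fun h => hne ⟨x, h.symm⟩
  obtain ⟨_, ⟨hyW, hyx⟩, ⟨y, rfl⟩⟩ := mem_closure_iff_nhds.1 hb _
    (Filter.inter_mem hW (isOpen_ne.mem_nhds hbx))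
  have hyx' : (y : K) - x ≠ 0 := fun h =>
    hyx (congrArg (algebraMap K (Adele K)) (sub_eq_zero.1 h))
  exact hWW _ hyW _ hxW (Units.mk0 _ hyx') (map_sub (algebraMap K (Adele K)) (y : K) x)

/-- The orbits of the ideles are closed. -/
lemma isClosed_orbit_idele (a : Idele K) : IsClosed (MulAction.orbit Kˣ (a : Adele K)) := by
  have h : MulAction.orbit Kˣ (a : Adele K) = (fun b => b * ((a⁻¹ : Idele K) : Adele K)) ⁻¹'
      Set.range fun x : Kˣ => algebraMap K (Adele K) x := by
    ext b
    constructor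
    · rintro ⟨x, rfl⟩
      refine ⟨x, ?_⟩
      simp only [unit_smul_eq, mul_assoc, Units.mul_inv, mul_one]
    · rintro ⟨x, hx⟩
      refine ⟨x, ?_⟩
      simp only [unit_smul_eq] at hx ⊢
      rw [hx, mul_assoc, Units.inv_mul, mul_one]
  rw [h]
  exact isClosed_range_algebraMap_units.preimage (continuous_id.mul continuous_const)

/-! ### The fibres of the map and the homeomorphism -/

lemma quasiOrbitXi_coe (c : Idele K) :
    quasiOrbitXi (c : Adele K) = QuasiOrbitModel.ofClass (QuotientGroup.mk c) := by
  rw [quasiOrbitXi, dif_pos c.isUnit]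
  congr 2
  exact Units.ext rfl

lemma quasiOrbitXi_of_not_isUnit {a : Adele K} (ha : ¬ IsUnit a) :
    quasiOrbitXi a = QuasiOrbitModel.ofSet (zeroPlaces a) := by
  rw [quasiOrbitXi, dif_neg ha]

lemma QuasiOrbitModel.ofSet_injective :
    Function.Injective (QuasiOrbitModel.ofSet : Set (Place K) → QuasiOrbitModel K) :=
  Sum.inl_injective

lemma QuasiOrbitModel.ofClass_injective :
    Function.Injective (QuasiOrbitModel.ofClass : IdeleClassGroup K → QuasiOrbitModel K) :=
  Sum.inr_injective

lemma QuasiOrbitModel.ofSet_ne_ofClass (T : Set (Place K)) (c : IdeleClassGroup K) :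
    QuasiOrbitModel.ofSet T ≠ QuasiOrbitModel.ofClass c :=
  Sum.inl_ne_inr

lemma exists_quasiOrbitXi_eq_ofSet (T : Set (Place K)) :
    ∃ a : Adele K, ¬ IsUnit a ∧ zeroPlaces a = T := by
  -- The adele 0 vanishes everywhere, which forces `F` to be empty and leaves `T` unrestricted.
  obtain ⟨F, hF, h⟩ := exists_not_isUnit_mem (0 : Adele K) Filter.univ_mem
  have h0 : zeroPlaces (0 : Adele K) = Set.univ :=
    Set.eq_univ_of_forall fun v => mem_zeroPlaces.2 (placeAbs_zero v)
  rw [h0, Set.univ_inter] at hF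
  obtain ⟨b, -, hb⟩ := h T (by rw [hF, Set.inter_empty])
  exact ⟨b, hb⟩

lemma quasiOrbitXi_surjective : Function.Surjective (quasiOrbitXi (K := K)) := by
  rintro (T | c)
  · obtain ⟨a, ha, rfl⟩ := exists_quasiOrbitXi_eq_ofSet T
    exact ⟨a, quasiOrbitXi_of_not_isUnit ha⟩
  · obtain ⟨c, rfl⟩ := QuotientGroup.mk_surjective c
    exact ⟨c, quasiOrbitXi_coe c⟩

lemma mk_idele_eq_iff (c d : Idele K) :
    (QuotientGroup.mk c : IdeleClassGroup K) = QuotientGroup.mk d ↔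
      ∃ x : Kˣ, x • (c : Adele K) = d := by
  rw [QuotientGroup.eq]
  constructor
  · rintro ⟨x, hx⟩
    refine ⟨x, ?_⟩
    have h : principalIdele K x * c = d := by rw [hx, mul_comm, mul_inv_cancel_left]
    rw [unit_smul_eq, ← h]
    rfl
  · rintro ⟨x, hx⟩
    refine ⟨x, ?_⟩
    have h : principalIdele K x * c = d := Units.ext ((unit_smul_eq x _).symm.trans hx)
    rw [← h, mul_comm, mul_inv_cancel_right]

lemma closure_orbit_idele (c : Idele K) :
    closure (MulAction.orbit Kˣ (c : Adele K)) = MulAction.orbit Kˣ (c : Adele K) :=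
  (isClosed_orbit_idele c).closure_eq

/-- The adele 0 lies in the first closure, while the second is a closed orbit made of units. -/
lemma closure_orbit_ne {a : Adele K} (ha : ¬ IsUnit a) (c : Idele K) :
    closure (MulAction.orbit Kˣ a) ≠ closure (MulAction.orbit Kˣ (c : Adele K)) := by
  rw [closure_orbit_idele, closure_orbit_of_not_isUnit ha]
  intro h
  have h0 : (0 : Adele K) ∈ {b : Adele K | zeroPlaces a ⊆ zeroPlaces b} :=
    fun v _ => mem_zeroPlaces.2 (placeAbs_zero v)
  rw [h] at h0
  obtain ⟨x, hx⟩ := h0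
  refine not_isUnit_zero_adele (K := K) ?_
  rw [← hx]
  exact c.isUnit.smul x

/-- The fibres of `Ξ` are the quasi-orbits. -/
lemma quasiOrbitXi_eq_iff (a b : Adele K) :
    quasiOrbitXi a = quasiOrbitXi b ↔
      closure (MulAction.orbit Kˣ a) = closure (MulAction.orbit Kˣ b) := by
  by_cases ha : IsUnit a <;> by_cases hb : IsUnit b
  · obtain ⟨c, rfl⟩ := ha
    obtain ⟨d, rfl⟩ := hb
    rw [quasiOrbitXi_coe, quasiOrbitXi_coe, QuasiOrbitModel.ofClass_injective.eq_iff,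
      closure_orbit_idele, closure_orbit_idele, eq_comm, mk_idele_eq_iff, MulAction.orbit_eq_iff]
    rfl
  · obtain ⟨c, rfl⟩ := ha
    rw [quasiOrbitXi_coe, quasiOrbitXi_of_not_isUnit hb]
    exact iff_of_false (QuasiOrbitModel.ofSet_ne_ofClass _ _).symm (closure_orbit_ne hb c).symm
  · obtain ⟨d, rfl⟩ := hb
    rw [quasiOrbitXi_coe, quasiOrbitXi_of_not_isUnit ha]
    exact iff_of_false (QuasiOrbitModel.ofSet_ne_ofClass _ _) (closure_orbit_ne ha d)
  · rw [quasiOrbitXi_of_not_isUnit ha, quasiOrbitXi_of_not_isUnit hb,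
      QuasiOrbitModel.ofSet_injective.eq_iff, closure_orbit_of_not_isUnit ha,
      closure_orbit_of_not_isUnit hb]
    refine ⟨fun h => by rw [h], fun h => ?_⟩
    rw [Set.ext_iff] at h
    exact Set.Subset.antisymm ((h b).2 (Set.Subset.refl _)) ((h a).1 (Set.Subset.refl _))

lemma continuous_quasiOrbitXi : Continuous (quasiOrbitXi (K := K)) :=
  continuous_coinduced_rng

/-- `Ξ` descends to a bijection from the quasi-orbit space. -/
def quasiOrbitEquiv : QuasiOrbitSpace Kˣ (Adele K) ≃ QuasiOrbitModel K :=
  Equiv.ofBijective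
    (Quotient.lift quasiOrbitXi fun a b h => (quasiOrbitXi_eq_iff a b).2 h) (by
      refine ⟨?_, fun y => ?_⟩
      · rintro ⟨a⟩ ⟨b⟩ h
        exact Quotient.sound ((quasiOrbitXi_eq_iff a b).1 h)
      · obtain ⟨a, rfl⟩ := quasiOrbitXi_surjective y
        exact ⟨quasiOrbitMap Kˣ (Adele K) a, rfl⟩)

/-- `Ξ` descends to a homeomorphism from the quasi-orbit space. -/
def quasiOrbitHomeomorph : QuasiOrbitSpace Kˣ (Adele K) ≃ₜ QuasiOrbitModel K where
  toEquiv := quasiOrbitEquiv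
  continuous_toFun := continuous_quasiOrbitXi.quotient_lift _
  continuous_invFun := by
    refine continuous_coinduced_dom.2 ?_
    have h : Continuous (quasiOrbitMap Kˣ (Adele K)) := continuous_quotient_mk'
    convert h using 1
    funext a
    exact quasiOrbitEquiv.symm_apply_apply (quasiOrbitMap Kˣ (Adele K) a)

/-! ### The basis of the quasi-orbit topology -/

lemma ideleClassNorm_mk (c : Idele K) :
    ideleClassNorm (QuotientGroup.mk c : IdeleClassGroup K) = ideleNorm c := rfl

lemma ofClass_mem_quasiOrbitBasic {F : Finset (Place K)} {ε : ℝ} {V : Set (IdeleClassGroup K)}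
    {c : IdeleClassGroup K} :
    QuasiOrbitModel.ofClass c ∈ quasiOrbitBasic F ε V ↔ ideleClassNorm c < ε ∨ c ∈ V := by
  simp only [quasiOrbitBasic, Set.mem_union, QuasiOrbitModel.ofClass_injective.mem_set_image]
  have : ¬ QuasiOrbitModel.ofClass c ∈ QuasiOrbitModel.ofSet '' powerCofiniteBasic F := by
    rintro ⟨T, -, h⟩
    exact QuasiOrbitModel.ofSet_ne_ofClass _ _ h
  simp only [this, false_or]
  rfl

lemma ofSet_mem_quasiOrbitBasic {F : Finset (Place K)} {ε : ℝ} {V : Set (IdeleClassGroup K)}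
    {T : Set (Place K)} :
    QuasiOrbitModel.ofSet T ∈ quasiOrbitBasic F ε V ↔ T ∩ F = ∅ := by
  simp only [quasiOrbitBasic, Set.mem_union, QuasiOrbitModel.ofSet_injective.mem_set_image]
  have h (V : Set (IdeleClassGroup K)) :
      ¬ QuasiOrbitModel.ofSet T ∈ QuasiOrbitModel.ofClass '' V := by
    rintro ⟨c, -, h⟩
    exact QuasiOrbitModel.ofSet_ne_ofClass _ _ h.symm
  simp only [h, or_false]
  rfl

/-- Being nonzero at the finitely many places of `F` is an open condition, so only the ideles near
`a` need checking. -/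
lemma quasiOrbitBasic_mem_nhds {F : Finset (Place K)} {ε : ℝ} {V : Set (IdeleClassGroup K)}
    {a : Adele K} (hF : zeroPlaces a ∩ F = ∅)
    (h : ∀ᶠ b in 𝓝 a, ∀ c : Idele K, (c : Adele K) = b →
      ideleNorm c < ε ∨ (QuotientGroup.mk c : IdeleClassGroup K) ∈ V) :
    quasiOrbitXi ⁻¹' quasiOrbitBasic F ε V ∈ 𝓝 a := by
  have hne : ∀ᶠ b in 𝓝 a, ∀ v ∈ F, placeAbs v b ≠ 0 := by
    refine (Filter.eventually_all_finset F).2 fun v hv => ?_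
    refine (continuous_placeAbs v).continuousAt.eventually_ne fun h0 => ?_
    exact (Set.ext_iff.1 hF v).1 ⟨mem_zeroPlaces.2 h0, hv⟩
  filter_upwards [hne, h] with b hb hb'
  by_cases hu : IsUnit b
  · obtain ⟨c, rfl⟩ := hu
    rw [Set.mem_preimage, quasiOrbitXi_coe, ofClass_mem_quasiOrbitBasic, ideleClassNorm_mk]
    exact hb' c rfl
  · rw [Set.mem_preimage, quasiOrbitXi_of_not_isUnit hu, ofSet_mem_quasiOrbitBasic]
    refine Set.eq_empty_of_forall_notMem fun v hv => hb v hv.2 (mem_zeroPlaces.1 hv.1)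

lemma zeroPlaces_idele (c : Idele K) : zeroPlaces (c : Adele K) = ∅ :=
  Set.eq_empty_of_forall_notMem fun v hv => (placeAbs_idele_pos c v).ne' (mem_zeroPlaces.1 hv)

lemma isOpen_quasiOrbitBasic (F : Finset (Place K)) {ε : ℝ} (hε : 0 < ε)
    {V : Set (IdeleClassGroup K)} (hV : IsOpen V) :
    IsOpen (quasiOrbitBasic F ε V) := by
  refine isOpen_coinduced.2 (isOpen_iff_mem_nhds.2 fun a ha => ?_)
  by_cases hu : IsUnit a
  · obtain ⟨c, rfl⟩ := hu
    refine quasiOrbitBasic_mem_nhds (by rw [zeroPlaces_idele, Set.empty_inter]) ?_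
    rw [Set.mem_preimage, quasiOrbitXi_coe, ofClass_mem_quasiOrbitBasic] at ha
    rcases ha with ha | ha
    · filter_upwards [eventually_ideleNorm_lt c ha] with b hb d hd
      exact Or.inl (hb d hd)
    · have hV' : (QuotientGroup.mk : Idele K → IdeleClassGroup K) ⁻¹' V ∈ 𝓝 c :=
        (hV.preimage QuotientGroup.continuous_mk).mem_nhds ha
      -- The comparison of topologies needs a strict lower bound; `ε / 2` provides it for all ideles
      -- of norm at least `ε`.
      filter_upwards [eventually_mem_of_lt_ideleNorm c hV' (half_pos hε)] with b hb d hd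
      rcases lt_or_ge (ideleNorm d) ε with h | h
      · exact Or.inl h
      · exact Or.inr (hb d hd ((half_lt_self hε).trans_le h))
  · rw [Set.mem_preimage, quasiOrbitXi_of_not_isUnit hu, ofSet_mem_quasiOrbitBasic] at ha
    refine quasiOrbitBasic_mem_nhds ha ?_
    filter_upwards [eventually_ideleNorm_lt_of_not_isUnit hu hε] with b hb d hd
    exact Or.inl (hb d hd)

lemma continuous_ideleClassNorm : Continuous (ideleClassNorm : IdeleClassGroup K → ℝ) :=
  continuous_ideleNorm.quotient_lift _

/-- The nonempty open sets contain all idele classes of small norm. -/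
lemma exists_ofClass_mem_of_ideleClassNorm_lt {W : Set (QuasiOrbitModel K)} (hW : IsOpen W)
    (hne : W.Nonempty) :
    ∃ ε > 0, ∀ c, ideleClassNorm c < ε → QuasiOrbitModel.ofClass c ∈ W := by
  obtain ⟨y, hy⟩ := hne
  obtain ⟨a, rfl⟩ := quasiOrbitXi_surjective y
  obtain ⟨ε, hε, h⟩ :=
    exists_smul_mem_of_ideleNorm_lt ((hW.preimage continuous_quasiOrbitXi).mem_nhds hy)
  refine ⟨ε, hε, fun c hc => ?_⟩
  obtain ⟨c, rfl⟩ := QuotientGroup.mk_surjective c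
  obtain ⟨x, hx⟩ := h c hc
  have hxc : x • (c : Adele K) = (principalIdele K x * c : Idele K) := unit_smul_eq x _
  rw [hxc, Set.mem_preimage, quasiOrbitXi_coe, ← (mk_idele_eq_iff c _).2 ⟨x, hxc⟩] at hx
  exact hx

/-- Openness of `W` at a single point supplies `F` and the classes of small norm; `V` is needed only
to capture the point itself when it is an idele class. -/
lemma exists_quasiOrbitBasic_subset {W : Set (QuasiOrbitModel K)} (hW : IsOpen W)
    {y : QuasiOrbitModel K} (hy : y ∈ W) :
    ∃ (F : Finset (Place K)) (ε : ℝ) (V : Set (IdeleClassGroup K)), 0 < ε ∧ IsOpen V ∧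
      (∀ c ∈ V, ε < ideleClassNorm c) ∧ y ∈ quasiOrbitBasic F ε V ∧ quasiOrbitBasic F ε V ⊆ W := by
  obtain ⟨ε₀, hε₀, hWε⟩ := exists_ofClass_mem_of_ideleClassNorm_lt hW ⟨y, hy⟩
  obtain ⟨a, rfl⟩ := quasiOrbitXi_surjective y
  obtain ⟨F, haF, hF⟩ :=
    exists_not_isUnit_mem a ((hW.preimage continuous_quasiOrbitXi).mem_nhds hy)
  have hsub {ε : ℝ} (h : ε ≤ ε₀) {V : Set (IdeleClassGroup K)}
      (hV : ∀ c ∈ V, QuasiOrbitModel.ofClass c ∈ W) : quasiOrbitBasic F ε V ⊆ W := by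
    rintro (T | c) hz
    · obtain ⟨b, hbW, hb, rfl⟩ := hF T (ofSet_mem_quasiOrbitBasic.1 hz)
      rw [Set.mem_preimage, quasiOrbitXi_of_not_isUnit hb] at hbW
      exact hbW
    · rcases ofClass_mem_quasiOrbitBasic.1 hz with hc | hc
      · exact hWε c (hc.trans_le h)
      · exact hV c hc
  by_cases hu : IsUnit a
  · obtain ⟨d, rfl⟩ := hu
    rw [quasiOrbitXi_coe] at hy
    -- Half the norm of `d` keeps the class of `d` strictly above `ε`, hence inside `V`.
    set ε := min ε₀ (ideleNorm d / 2) with hε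
    refine ⟨F, ε, {c | QuasiOrbitModel.ofClass c ∈ W ∧ ε < ideleClassNorm c},
      lt_min hε₀ (half_pos (ideleNorm_pos d)), ?_, fun c hc => hc.2, ?_,
      hsub (min_le_left _ _) fun c hc => hc.1⟩
    · suffices IsOpen {c | QuasiOrbitModel.ofClass c ∈ W} from
        this.inter (isOpen_lt continuous_const continuous_ideleClassNorm)
      rw [← QuotientGroup.isOpenQuotientMap_mk.isQuotientMap.isOpen_preimage]
      have h : (QuotientGroup.mk : Idele K → IdeleClassGroup K) ⁻¹'
          {c | QuasiOrbitModel.ofClass c ∈ W} = Units.val ⁻¹' (quasiOrbitXi ⁻¹' W) := by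
        ext c
        simp only [Set.mem_preimage, quasiOrbitXi_coe]
        rfl
      rw [h]
      exact (hW.preimage continuous_quasiOrbitXi).preimage Units.continuous_val
    · rw [quasiOrbitXi_coe, ofClass_mem_quasiOrbitBasic]
      exact Or.inr ⟨hy, (min_le_right _ _).trans_lt (half_lt_self (ideleNorm_pos d))⟩
  · refine ⟨F, ε₀, ∅, hε₀, isOpen_empty, by simp, ?_, hsub le_rfl (by simp)⟩
    rw [quasiOrbitXi_of_not_isUnit hu, ofSet_mem_quasiOrbitBasic]
    exact haF

end NumberField

end

theorem mainTheorem4 (K : Type*) [Field K] [NumberField K] :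
    (∃ e : QuasiOrbitSpace Kˣ (Adele K) ≃ₜ QuasiOrbitModel K,
      ∀ a : Adele K, e (quasiOrbitMap Kˣ (Adele K) a) = quasiOrbitXi a) ∧
    (∀ (F : Finset (Place K)) (ε : ℝ) (V : Set (IdeleClassGroup K)),
      0 < ε → IsOpen V → (∀ c ∈ V, ε < ideleClassNorm c) →
        IsOpen (quasiOrbitBasic F ε V)) ∧
    TopologicalSpace.IsTopologicalBasis
      {U : Set (QuasiOrbitModel K) |
        ∃ (F : Finset (Place K)) (ε : ℝ) (V : Set (IdeleClassGroup K)),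
          0 < ε ∧ IsOpen V ∧ (∀ c ∈ V, ε < ideleClassNorm c) ∧
          U = quasiOrbitBasic F ε V} := by
  refine ⟨⟨quasiOrbitHomeomorph, fun a => rfl⟩,
    fun F _ _ hε hV _ => isOpen_quasiOrbitBasic F hε hV,
    TopologicalSpace.isTopologicalBasis_of_isOpen_of_nhds ?_ fun y W hy hW => ?_⟩
  · rintro _ ⟨F, ε, V, hε, hV, -, rfl⟩
    exact isOpen_quasiOrbitBasic F hε hV
  · obtain ⟨F, ε, V, hε, hV, h, hyU, hU⟩ := exists_quasiOrbitBasic_subset hW hy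
    exact ⟨_, ⟨F, ε, V, hε, hV, h, rfl⟩, hyU, hU⟩
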